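/- Let $a>0$ and $u_s>0$. For $L>0$ and $s\in L^2(0,L)$ let $\mathrm{sat}(s)=s$ if $\|s\|_{L^2(0,L)}\le u_s$ and $\mathrm{sat}(s)=\frac{u_s}{\|s\|_{L^2(0,L)}}\,s$ otherwise, and consider the Korteweg-de Vries equation $$y_t+y_x+y_{xxx}+yy_x+\mathrm{sat}(ay)=0,\quad y(t,0)=y(t,L)=y_x(t,L)=0,\quad y(0,x)=y_0(x),\qquad t\ge 0,\ x\in[0,L].\qquad(1)$$ Let $W$ be the strongly continuous semigroup on $L^2(0,L)$ generated by $Aw=-w'-w'''$ with domain $D(A)=\{w\in H^3(0,L): w(0)=w(L)=w'(L)=0\}$. A mild solution of (1) with initial condition $y_0\in L^2(0,L)$ is a function $y$ on $[0,\infty)$ that lies in $C([0,T];L^2(0,L))\cap L^2(0,T;H^1(0,L))$ for every $T>0$ and satisfies, for all $t\ge 0$, $$y(t)=W(t)y_0-\int_0^t W(t-\tau)\,(yy_x)(\tau)\,d\tau-\int_0^t W(t-\tau)\,\mathrm{sat}(ay(\tau))\,d\tau .$$ Then: 1. There is a class $\mathcal K$ function $\alpha:\mathbb R_{\ge0}\to\mathbb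 R_{\ge0}$ (continuous, strictly increasing, $\alpha(0)=0$), depending only on $a$ and $u_s$, such that for every $L>0$, every $y_0\in L^2(0,L)$ and every mild solution $y$ of (1), $$\|y(t,\cdot)\|_{L^2(0,L)}\le \alpha(\|y_0\|_{L^2(0,L)})\,e^{-at}\qquad\text{for all } t\ge 0.$$ 2. For every $r>0$, every $L>0$, every $y_0\in L^2(0,L)$ with $\|y_0\|_{L^2(0,L)}\le r$ and every mild solution $y$ of (1), $$\|y(t,\cdot)\|_{L^2(0,L)}\le \|y_0\|_{L^2(0,L)}\,e^{-\mu t}\qquad\text{for all } t\ge 0,\qquad \mu:=\min\Big\{a,\frac{u_s}{r}\Big\}.$$ -/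

import Mathlib

open MeasureTheory Set Filter Topology
open scoped NNReal ENNReal ContDiff

noncomputable section

namespace SatKdV

/-- The real Hilbert space `L²(0,L)`. -/
abbrev L2 (L : ℝ) : Type := Lp ℝ 2 (volume.restrict (Ioo (0 : ℝ) L))

/-- `v ∈ L²(0,L)` is the weak (distributional) derivative of `w ∈ L²(0,L)` on `(0,L)`.
Hence `w ∈ H¹(0,L)` means that such a `v` exists. -/
def HasWeakDeriv (L : ℝ) (w v : L2 L) : Prop :=
  ∀ φ : ℝ → ℝ, ContDiff ℝ ∞ φ → HasCompactSupport φ → tsupport φ ⊆ Ioo 0 L →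
    ∫ x in Ioo 0 L, w x * deriv φ x = -∫ x in Ioo 0 L, v x * φ x

/-- The value at `x ∈ [0,L]` of the representative of `w` that is continuous on `[0,L]`
exists and is `c` (boundary values are meant in this sense). -/
def HasValueAt (L : ℝ) (w : L2 L) (x c : ℝ) : Prop :=
  ∃ f : ℝ → ℝ, ContinuousOn f (Icc 0 L) ∧ (w =ᵐ[volume.restrict (Ioo 0 L)] f) ∧ f x = c

/-- The graph of the linear KdV operator `A w = -w' - w'''` with domain
`D(A) = {w ∈ H³(0,L) : w(0) = w(L) = w'(L) = 0}`: the relation says that `w ∈ D(A)` and `A w = z`. -/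
def KdVOperatorGraph (L : ℝ) (w z : L2 L) : Prop :=
  ∃ w₁ w₂ w₃ : L2 L,
    HasWeakDeriv L w w₁ ∧ HasWeakDeriv L w₁ w₂ ∧ HasWeakDeriv L w₂ w₃ ∧
    HasValueAt L w 0 0 ∧ HasValueAt L w L 0 ∧ HasValueAt L w₁ L 0 ∧
    z = -w₁ - w₃

/-- Strongly continuous one-parameter semigroup of bounded operators
(only the values `W t` with `t ≥ 0` matter). -/
structure IsC0Semigroup {X : Type*} [NormedAddCommGroup X] [NormedSpace ℝ X]
    (W : ℝ → X →L[ℝ] X) : Prop where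
  map_zero : W 0 = ContinuousLinearMap.id ℝ X
  map_add : ∀ s t : ℝ, 0 ≤ s → 0 ≤ t → W (s + t) = (W s).comp (W t)
  tendsto_zero : ∀ x : X, Tendsto (fun t => W t x) (𝓝[>] 0) (𝓝 x)

/-- The graph of the infinitesimal generator of `W`: the strong right derivative of
`t ↦ W t x` at `0` exists and is `z`. -/
def GeneratorGraph {X : Type*} [NormedAddCommGroup X] [NormedSpace ℝ X]
    (W : ℝ → X →L[ℝ] X) (x z : X) : Prop :=
  Tendsto (fun t : ℝ => t⁻¹ • (W t x - x)) (𝓝[>] 0) (𝓝 z)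

/-- `W` is the strongly continuous semigroup on `L²(0,L)` whose infinitesimal generator is
exactly the linear KdV operator (same domain, same values); it is unique for `t ≥ 0`. -/
def IsKdVSemigroup (L : ℝ) (W : ℝ → L2 L →L[ℝ] L2 L) : Prop :=
  IsC0Semigroup W ∧ ∀ w z : L2 L, GeneratorGraph W w z ↔ KdVOperatorGraph L w z

/-- Saturation in `L²`-norm at level `us`. -/
def sat (us : ℝ) {L : ℝ} (s : L2 L) : L2 L :=
  if ‖s‖ ≤ us then s else (us / ‖s‖) • s

open Classical in
/-- The pointwise product of `f, g ∈ L²(0,L)` as an element of `L²(0,L)`. It is only used for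
`f ∈ H¹(0,L)`, where `f` is bounded and the product is in `L²(0,L)`; otherwise, if the product is
not square integrable, the value is `0`. -/
def mulL2 {L : ℝ} (f g : L2 L) : L2 L :=
  if h : MemLp (fun x => f x * g x) 2 (volume.restrict (Ioo (0 : ℝ) L)) then h.toLp _ else 0

/-- `y` (restricted to times `t ≥ 0`) is a mild solution on `[0,∞)` of
`y_t + y_x + y_xxx + y y_x + sat(a y) = 0`, `y(t,0) = y(t,L) = y_x(t,L) = 0`, `y(0,·) = y₀`:
it is in `C([0,T]; L²(0,L)) ∩ L²(0,T; H¹(0,L))` for every `T > 0`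
and satisfies the variation-of-constants formula
`y(t) = W(t) y₀ - ∫₀ᵗ W(t-τ) (y y_x)(τ) dτ - ∫₀ᵗ W(t-τ) sat(a y(τ)) dτ`.
The function `yx` is `t ↦ y_x(t,·)`; it is determined by `y` for almost every `t > 0`. -/
def IsMildSolution (L a us : ℝ) (y₀ : L2 L) (y : ℝ → L2 L) : Prop :=
  ContinuousOn y (Ici 0) ∧
  ∃ yx : ℝ → L2 L,
    (∀ T : ℝ, 0 < T → MemLp yx 2 (volume.restrict (Ioo 0 T))) ∧
    (∀ᵐ t ∂(volume.restrict (Ioi (0 : ℝ))), HasWeakDeriv L (y t) (yx t)) ∧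
    ∃ W : ℝ → L2 L →L[ℝ] L2 L, IsKdVSemigroup L W ∧
      ∀ t : ℝ, 0 ≤ t →
        y t = W t y₀ - (∫ τ in (0 : ℝ)..t, W (t - τ) (mulL2 (y τ) (yx τ)))
          - ∫ τ in (0 : ℝ)..t, W (t - τ) (sat us (a • y τ))

/-- Class `𝒦` functions `ℝ≥0 → ℝ≥0`. -/
structure IsClassK (α : ℝ≥0 → ℝ≥0) : Prop where
  continuous : Continuous α
  strictMono : StrictMono α
  map_zero : α 0 = 0

end SatKdV

end

/-!
The linear operator `A w = -w_x - w_xxx` with the boundary conditions `w(0) = w(L) = w_x(L) = 0`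
is dissipative: integration by parts gives `⟨A w, w⟩ = -w_x(0)² / 2` (`KdVOperatorGraph.inner_nonpos`).
Hence the semigroup `W` consists of contractions (`IsC0Semigroup.norm_apply_le`), and every mild
solution of `y' = A y - f` with `f` locally integrable in time satisfies the energy inequality
`‖y(t)‖² ≤ ‖y(s)‖² - 2 ∫ₛᵗ ⟨y, f⟩` (`IsMildSol.energy_le`). This is obtained directly from the
variation-of-constants formula on short time steps, without regularising the data.

With `f = y y_x + sat(a y)` the nonlinear term does not contribute, because `∫ y² y_x = [y³ / 3] = 0`
(`HasWeakDeriv.inner_mulL2_eq_zero`). This needs `y(t)` to vanish at both ends for almost every `t`,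
which is not part of the notion of mild solution. It follows from the semigroup: the time integrals
`∫₀ᵀ y` lie in the domain of `A` (`IsMildSol.exists_generatorGraph`), the boundary values are bounded
functionals on `H¹(0,L)`, and a locally integrable function all of whose primitives vanish is zero
almost everywhere.

Since `⟨y, sat(a y)⟩ = min (a ‖y‖) us ‖y‖` (`inner_sat`), the function `N = ‖y(·)‖` satisfies
`N(t)² ≤ N(s)² - 2 ∫ₛᵗ min (a N) us N` (`IsMildSolution.satEnergy`). So `N` is nonincreasing, and as
long as `N ≤ r` it decays at the rate `min a (us / r)` (`SatEnergy.le_mul_exp`). After the time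
`T = a N(0)² / (2 us²)` one has `N ≤ us / a`, so that the rate is `a` from then on; the price is the
factor `exp (a T)`, which gives the class `𝒦` function `s ↦ s exp (a² s² / (2 us²))`
(`SatEnergy.le_mul_exp_global`).
-/

namespace SatKdV

/-! ### Strongly continuous semigroups -/

section Banach

variable {X : Type*} [NormedAddCommGroup X] [NormedSpace ℝ X] {W : ℝ → X →L[ℝ] X}

theorem IsC0Semigroup.tendsto_zero_right (hW : IsC0Semigroup W) (x : X) :
    Tendsto (fun t => W t x) (𝓝[≥] 0) (𝓝 x) := by
  rw [← Ioi_insert, nhdsWithin_insert, tendsto_sup]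
  refine ⟨?_, hW.tendsto_zero x⟩
  rw [tendsto_pure_left]
  intro s hs
  simpa [hW.map_zero] using mem_of_mem_nhds hs

/-- Otherwise `‖W (t n)‖ → ∞` along some `t n → 0`, against the uniform boundedness principle. -/
theorem IsC0Semigroup.exists_norm_le_near_zero [CompleteSpace X] (hW : IsC0Semigroup W) :
    ∃ δ > 0, ∃ M : ℝ, ∀ t ∈ Icc 0 δ, ‖W t‖ ≤ M := by
  by_contra! hcon
  choose t ht hbig using fun n : ℕ => hcon (1 / ((n : ℝ) + 1)) (by positivity) n
  have ht0 : Tendsto t atTop (𝓝[≥] 0) := by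
    refine tendsto_nhdsWithin_iff.2 ⟨?_, Eventually.of_forall fun n => (ht n).1⟩
    exact squeeze_zero (fun n => (ht n).1) (fun n => (ht n).2) tendsto_one_div_add_atTop_nhds_zero_nat
  obtain ⟨C, hC⟩ := banach_steinhaus (g := fun n => W (t n)) fun x => by
    have h := ((hW.tendsto_zero_right x).comp ht0).norm.bddAbove_range
    obtain ⟨C, hC⟩ := h
    exact ⟨C, fun n => hC ⟨n, rfl⟩⟩
  obtain ⟨n, hn⟩ := exists_nat_gt C
  exact absurd (hC n) (not_le.2 (hn.trans (hbig n)))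

theorem IsC0Semigroup.exists_norm_le [CompleteSpace X] (hW : IsC0Semigroup W) (T : ℝ) :
    ∃ M : ℝ, 0 ≤ M ∧ ∀ t ∈ Icc 0 T, ‖W t‖ ≤ M := by
  obtain ⟨δ, hδ, M, hM⟩ := hW.exists_norm_le_near_zero
  have hM0 : 0 ≤ M := (norm_nonneg _).trans (hM 0 ⟨le_rfl, hδ.le⟩)
  have key : ∀ n : ℕ, ∃ C : ℝ, 0 ≤ C ∧ ∀ t ∈ Icc 0 (n * δ), ‖W t‖ ≤ C := by
    intro n
    induction n with
    | zero =>
      refine ⟨M, hM0, fun t ht => hM t ⟨ht.1, ht.2.trans (by simpa using hδ.le)⟩⟩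
    | succ n ih =>
      obtain ⟨C, hC0, hC⟩ := ih
      refine ⟨max C (M * C), le_max_of_le_left hC0, fun t ht => ?_⟩
      rcases le_total t (n * δ) with h | h
      · exact (hC t ⟨ht.1, h⟩).trans (le_max_left _ _)
      · have h1 : W t = (W (t - n * δ)).comp (W (n * δ)) := by
          rw [← hW.map_add _ _ (sub_nonneg.2 h) (by positivity)]; simp
        rw [h1]
        refine (ContinuousLinearMap.opNorm_comp_le _ _).trans (le_max_of_le_right ?_)
        have h2 := ht.2
        push_cast at h2
        exact mul_le_mul (hM _ ⟨sub_nonneg.2 h, by linarith⟩) (hC _ ⟨by positivity, le_rfl⟩)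
          (norm_nonneg _) hM0
  obtain ⟨n, hn⟩ := exists_nat_ge (T / δ)
  obtain ⟨C, hC0, hC⟩ := key n
  exact ⟨C, hC0, fun t ht => hC t ⟨ht.1, ht.2.trans ((div_le_iff₀ hδ).1 hn)⟩⟩

theorem IsC0Semigroup.norm_sub_le (hW : IsC0Semigroup W) {T M : ℝ}
    (hM : ∀ t ∈ Icc 0 T, ‖W t‖ ≤ M) {s t : ℝ} (hs : s ∈ Icc 0 T) (ht : t ∈ Icc 0 T) (x : X) :
    ‖W s x - W t x‖ ≤ M * ‖W |s - t| x - x‖ := by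
  wlog hst : t ≤ s generalizing s t
  · rw [norm_sub_rev, abs_sub_comm]
    exact this ht hs (le_of_not_ge hst)
  have h1 : W s x = W t (W (s - t) x) := by
    rw [← ContinuousLinearMap.comp_apply, ← hW.map_add _ _ ht.1 (sub_nonneg.2 hst)]; simp
  rw [h1, abs_of_nonneg (sub_nonneg.2 hst), ← map_sub]
  exact (W t).le_of_opNorm_le (hM t ht) _

theorem IsC0Semigroup.continuousOn [CompleteSpace X] (hW : IsC0Semigroup W) (x : X) :
    ContinuousOn (fun t => W t x) (Ici 0) := by
  intro t ht
  obtain ⟨M, hM0, hM⟩ := hW.exists_norm_le (t + 1)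
  rw [ContinuousWithinAt, tendsto_iff_norm_sub_tendsto_zero]
  have h0 : Tendsto (fun s => |s - t|) (𝓝[Ici 0] t) (𝓝[≥] 0) := by
    refine tendsto_nhdsWithin_iff.2 ⟨?_, Eventually.of_forall fun s => mem_Ici.2 (abs_nonneg _)⟩
    have : Continuous fun s : ℝ => |s - t| := by fun_prop
    simpa using (this.tendsto t).mono_left nhdsWithin_le_nhds
  have h1 := ((hW.tendsto_zero_right x).comp h0).sub_const x |>.norm.const_mul M
  simp only [sub_self, norm_zero, mul_zero] at h1
  refine squeeze_zero' (Eventually.of_forall fun _ => norm_nonneg _) ?_ h1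
  filter_upwards [self_mem_nhdsWithin, mem_nhdsWithin_of_mem_nhds (Iio_mem_nhds (lt_add_one t))]
    with s hs hs'
  exact hW.norm_sub_le hM ⟨hs, le_of_lt hs'⟩ ⟨ht, (lt_add_one t).le⟩ x

/-- Truncating the time at `0` gives orbits that are continuous on the whole line. -/
theorem IsC0Semigroup.continuous_max [CompleteSpace X] (hW : IsC0Semigroup W) (x : X) :
    Continuous (fun t => W (max t 0) x) :=
  (hW.continuousOn x).comp_continuous (by fun_prop) fun t => le_max_right t 0

/-- The generator commutes with the semigroup. -/
theorem IsC0Semigroup.generatorGraph_apply (hW : IsC0Semigroup W) {x z : X}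
    (h : GeneratorGraph W x z) {t : ℝ} (ht : 0 ≤ t) : GeneratorGraph W (W t x) (W t z) := by
  refine (((W t).continuous.tendsto z).comp h).congr' ?_
  filter_upwards [self_mem_nhdsWithin] with s hs
  have hs' : (0 : ℝ) ≤ s := le_of_lt hs
  simp only [Function.comp, map_smul, map_sub, ← ContinuousLinearMap.comp_apply]
  rw [← hW.map_add _ _ ht hs', ← hW.map_add _ _ hs' ht, add_comm]

theorem IsC0Semigroup.hasDerivWithinAt (hW : IsC0Semigroup W) {x z : X}
    (h : GeneratorGraph W x z) {t : ℝ} (ht : 0 ≤ t) :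
    HasDerivWithinAt (fun s => W s x) (W t z) (Ici t) t := by
  rw [hasDerivWithinAt_iff_tendsto_slope, Ici_sdiff_left]
  have h1 := hW.generatorGraph_apply h ht
  have h2 : Tendsto (fun s => s - t) (𝓝[>] t) (𝓝[>] 0) := by
    refine tendsto_nhdsWithin_iff.2 ⟨?_, ?_⟩
    · have : Continuous fun s : ℝ => s - t := by fun_prop
      simpa using (this.tendsto t).mono_left nhdsWithin_le_nhds
    · filter_upwards [self_mem_nhdsWithin] with s hs
      exact sub_pos.2 (mem_Ioi.1 hs)
  refine (h1.comp h2).congr' ?_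
  filter_upwards [self_mem_nhdsWithin] with s hs
  have hs' : (0 : ℝ) ≤ s - t := (sub_pos.2 (mem_Ioi.1 hs)).le
  simp only [Function.comp, slope, vsub_eq_sub, ← ContinuousLinearMap.comp_apply]
  rw [← hW.map_add _ _ hs' ht, sub_add_cancel]

theorem GeneratorGraph.sub {x x' z z' : X} (h : GeneratorGraph W x z)
    (h' : GeneratorGraph W x' z') : GeneratorGraph W (x - x') (z - z') := by
  refine (Tendsto.sub h h').congr fun t => ?_
  rw [← smul_sub, map_sub]
  congr 1; abel

theorem GeneratorGraph.const_smul {x z : X} (c : ℝ) (h : GeneratorGraph W x z) :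
    GeneratorGraph W (c • x) (c • z) := by
  refine (Tendsto.const_smul h c).congr fun t => ?_
  rw [map_smul, ← smul_sub, smul_comm]

theorem tendsto_average_right [CompleteSpace X] {g : ℝ → X} (hg : Continuous g) (t : ℝ) :
    Tendsto (fun h : ℝ => h⁻¹ • ∫ s in t..t + h, g s) (𝓝[>] 0) (𝓝 (g t)) := by
  have h1 : HasDerivAt (fun u => ∫ s in t..u, g s) (g t) t :=
    intervalIntegral.integral_hasDerivAt_right (hg.intervalIntegrable _ _)
      hg.stronglyMeasurable.stronglyMeasurableAtFilter hg.continuousAt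
  simpa using h1.tendsto_slope_zero_right

/-- Time integrals of orbits are in the domain of the generator. -/
theorem IsC0Semigroup.generatorGraph_integral [CompleteSpace X] (hW : IsC0Semigroup W) (x : X)
    {t : ℝ} (ht : 0 ≤ t) :
    GeneratorGraph W (∫ s in (0 : ℝ)..t, W (max s 0) x) (W t x - x) := by
  have hc := hW.continuous_max x
  have hint : ∀ a b, IntervalIntegrable (fun s => W (max s 0) x) volume a b :=
    fun a b => hc.intervalIntegrable a b
  have h1 := (tendsto_average_right hc t).sub (tendsto_average_right hc 0)
  simp only [max_eq_left ht, max_self, hW.map_zero, ContinuousLinearMap.id_apply, zero_add] at h1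
  refine h1.congr' ?_
  filter_upwards [self_mem_nhdsWithin] with h hh
  have hh' : (0 : ℝ) ≤ h := le_of_lt hh
  rw [← smul_sub]
  congr 1
  have h2 : W h (∫ s in (0 : ℝ)..t, W (max s 0) x) = ∫ s in (0 : ℝ)..t, W (max (s + h) 0) x := by
    rw [← ContinuousLinearMap.intervalIntegral_comp_comm _ (hint _ _)]
    refine intervalIntegral.integral_congr fun s hs => ?_
    rw [uIcc_of_le ht] at hs
    rw [max_eq_left hs.1, max_eq_left (add_nonneg hs.1 hh'), ← ContinuousLinearMap.comp_apply,
      ← hW.map_add _ _ hh' hs.1, add_comm]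
  rw [h2, intervalIntegral.integral_comp_add_right (fun s => W (max s 0) x), zero_add]
  have h3 := intervalIntegral.integral_add_adjacent_intervals (hint 0 h) (hint h (t + h))
  have h4 := intervalIntegral.integral_add_adjacent_intervals (hint 0 t) (hint t (t + h))
  rw [sub_eq_sub_iff_add_eq_add, add_comm (∫ s in t..t + h, _), add_comm (∫ s in h..t + h, _), h3, h4]

theorem IsC0Semigroup.dense_domain [CompleteSpace X] (hW : IsC0Semigroup W) :
    Dense {x : X | ∃ z, GeneratorGraph W x z} := by
  intro x
  have hc := tendsto_average_right (hW.continuous_max x) 0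
  simp only [max_self, hW.map_zero, ContinuousLinearMap.id_apply, zero_add] at hc
  refine mem_closure_of_tendsto hc ?_
  filter_upwards [self_mem_nhdsWithin] with h hh
  exact ⟨_, (hW.generatorGraph_integral x (le_of_lt hh)).const_smul _⟩

end Banach

/-! ### Contraction semigroups -/

section Contraction

variable {X : Type*} [NormedAddCommGroup X] [NormedSpace ℝ X] {W : ℝ → X →L[ℝ] X}

/-- Continuity in `(t, x)` jointly; the time is truncated at `0` because only `t ≥ 0` matters. -/
theorem IsC0Semigroup.continuous_uncurry_max [CompleteSpace X] (hW : IsC0Semigroup W)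
    (hc : ∀ t, 0 ≤ t → ∀ x, ‖W t x‖ ≤ ‖x‖) :
    Continuous fun p : ℝ × X => W (max p.1 0) p.2 := by
  rw [continuous_iff_continuousAt]
  rintro ⟨t, x⟩
  rw [ContinuousAt, tendsto_iff_norm_sub_tendsto_zero]
  have h1 : Tendsto (fun p : ℝ × X => ‖p.2 - x‖ + ‖W (max p.1 0) x - W (max t 0) x‖) (𝓝 (t, x))
      (𝓝 0) := by
    have h : Continuous fun p : ℝ × X => ‖p.2 - x‖ + ‖W (max p.1 0) x - W (max t 0) x‖ := by
      exact (continuous_snd.sub continuous_const).norm.add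
        (((hW.continuous_max x).comp continuous_fst).sub continuous_const).norm
    simpa using h.tendsto (t, x)
  refine squeeze_zero (fun _ => norm_nonneg _) (fun p => ?_) h1
  have h3 : W (max p.1 0) p.2 - W (max t 0) x
      = W (max p.1 0) (p.2 - x) + (W (max p.1 0) x - W (max t 0) x) := by
    rw [map_sub]; abel
  rw [h3]
  exact (norm_add_le _ _).trans (add_le_add_left (hc _ (le_max_right _ _) _) _)

theorem IsC0Semigroup.norm_apply_sub_le [CompleteSpace X] (hW : IsC0Semigroup W)
    (hc : ∀ t, 0 ≤ t → ∀ x, ‖W t x‖ ≤ ‖x‖) {x z : X} (h : GeneratorGraph W x z) {t : ℝ}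
    (ht : 0 ≤ t) : ‖W t x - x‖ ≤ t * ‖z‖ := by
  have := norm_image_sub_le_of_norm_deriv_right_le_segment (f := fun s => W s x)
    (f' := fun s => W s z) (a := 0) (b := t) (C := ‖z‖)
    ((hW.continuousOn x).mono fun s hs => hs.1) (fun s hs => hW.hasDerivWithinAt h hs.1)
    (fun s hs => hc s hs.1 z) t ⟨ht, le_rfl⟩
  simpa [hW.map_zero, mul_comm] using this

/-- The generator of a contraction semigroup commutes with Bochner integrals. -/
theorem IsC0Semigroup.generatorGraph_intervalIntegral [CompleteSpace X] (hW : IsC0Semigroup W)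
    (hc : ∀ t, 0 ≤ t → ∀ x, ‖W t x‖ ≤ ‖x‖) {u z : ℝ → X} {T : ℝ} (hT : 0 ≤ T)
    (hu : IntervalIntegrable u volume 0 T) (hz : IntervalIntegrable z volume 0 T)
    (h : ∀ s ∈ Icc 0 T, GeneratorGraph W (u s) (z s)) :
    GeneratorGraph W (∫ s in (0 : ℝ)..T, u s) (∫ s in (0 : ℝ)..T, z s) := by
  have hmem : ∀ {s}, s ∈ uIoc 0 T → s ∈ Icc 0 T := fun hs => by
    rw [uIoc_of_le hT] at hs; exact Ioc_subset_Icc_self hs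
  have hWu : ∀ r, IntervalIntegrable (fun s => W r (u s)) volume 0 T := fun r =>
    ⟨(W r).integrable_comp hu.1, (W r).integrable_comp hu.2⟩
  have key : Tendsto (fun r : ℝ => ∫ s in (0 : ℝ)..T, r⁻¹ • (W r (u s) - u s)) (𝓝[>] 0)
      (𝓝 (∫ s in (0 : ℝ)..T, z s)) := by
    refine intervalIntegral.tendsto_integral_filter_of_dominated_convergence (fun s => ‖z s‖)
      ?_ ?_ hz.norm ?_
    · refine Eventually.of_forall fun r => ?_
      exact (((hWu r).sub hu).smul r⁻¹).aestronglyMeasurable_restrict_uIoc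
    · filter_upwards [self_mem_nhdsWithin] with r hr
      refine Eventually.of_forall fun s hs => ?_
      have hr' : (0 : ℝ) < r := hr
      rw [norm_smul, norm_inv, Real.norm_of_nonneg hr'.le, inv_mul_le_iff₀ hr']
      exact hW.norm_apply_sub_le hc (h s (hmem hs)) hr'.le
    · exact Eventually.of_forall fun s hs => h s (hmem hs)
  refine key.congr fun r => ?_
  rw [intervalIntegral.integral_smul, intervalIntegral.integral_sub (hWu r) hu,
    ContinuousLinearMap.intervalIntegral_comp_comm _ hu]

end Contraction

section Hilbert

variable {H : Type*} [NormedAddCommGroup H] [InnerProductSpace ℝ H] {W : ℝ → H →L[ℝ] H}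

/-- A semigroup with dissipative generator is contractive: on the domain the squared norm of an
orbit has a nonpositive right derivative, and the domain is dense. -/
theorem IsC0Semigroup.norm_apply_le [CompleteSpace H] (hW : IsC0Semigroup W)
    (hd : ∀ x z, GeneratorGraph W x z → inner ℝ x z ≤ 0) {t : ℝ} (ht : 0 ≤ t) (x : H) :
    ‖W t x‖ ≤ ‖x‖ := by
  refine hW.dense_domain.induction (P := fun x => ‖W t x‖ ≤ ‖x‖) ?_ ?_ x
  · rintro x ⟨z, hz⟩
    have h := image_le_of_deriv_right_le_deriv_boundary (f := fun s => ‖W s x‖ ^ 2)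
      (f' := fun s => 2 * inner ℝ (W s x) (W s z)) (a := 0) (b := t) (B := fun _ => ‖x‖ ^ 2)
      (B' := fun _ => 0) (((hW.continuousOn x).mono fun s hs => hs.1).norm.pow 2)
      (fun s hs => (hW.hasDerivWithinAt hz hs.1).norm_sq) (by simp [hW.map_zero])
      continuousOn_const (fun s _ => hasDerivWithinAt_const _ _ _)
      (fun s hs => by
        have := hd _ _ (hW.generatorGraph_apply hz hs.1)
        linarith) (x := t) ⟨ht, le_rfl⟩
    exact (pow_le_pow_iff_left₀ (norm_nonneg _) (norm_nonneg _) two_ne_zero).1 h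
  · exact isClosed_le (by fun_prop) (by fun_prop)

end Hilbert

/-! ### Mild solutions of dissipative evolution equations -/

section Mild

variable {X : Type*} [NormedAddCommGroup X] [NormedSpace ℝ X] {W : ℝ → X →L[ℝ] X}

theorem IsC0Semigroup.intervalIntegrable_apply [CompleteSpace X] (hW : IsC0Semigroup W)
    (hc : ∀ t, 0 ≤ t → ∀ x, ‖W t x‖ ≤ ‖x‖) {f : ℝ → X} {a b : ℝ}
    (hf : IntervalIntegrable f volume a b) {c : ℝ → ℝ} (hcm : Measurable c) :
    IntervalIntegrable (fun s => W (max (c s) 0) (f s)) volume a b := by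
  refine hf.norm.mono_fun ?_ ?_
  · exact (hW.continuous_uncurry_max hc).comp_aestronglyMeasurable
      (hcm.aestronglyMeasurable.prodMk hf.aestronglyMeasurable_restrict_uIoc)
  · refine Eventually.of_forall fun s => ?_
    simpa using hc _ (le_max_right _ _) _

/-- `y` is a mild solution of `y' = A y - f`, `y 0 = y₀`, where `W` is the semigroup of `A`.
The truncation of `t - s` at `0` has no effect for `0 ≤ s ≤ t`; it makes the integrand measurable. -/
def IsMildSol (W : ℝ → X →L[ℝ] X) (f : ℝ → X) (y₀ : X) (y : ℝ → X) : Prop :=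
  ∀ t, 0 ≤ t → y t = W t y₀ - ∫ s in (0 : ℝ)..t, W (max (t - s) 0) (f s)

/-- The variation-of-constants formula with initial time `s`. -/
theorem IsMildSol.restart [CompleteSpace X] (hW : IsC0Semigroup W)
    (hc : ∀ t, 0 ≤ t → ∀ x, ‖W t x‖ ≤ ‖x‖) {f : ℝ → X} {y₀ : X} {y : ℝ → X}
    (hf : ∀ T, 0 ≤ T → IntervalIntegrable f volume 0 T) (hy : IsMildSol W f y₀ y) {s t : ℝ}
    (hs : 0 ≤ s) (hst : s ≤ t) :
    y t = W (t - s) (y s) - ∫ r in s..t, W (max (t - r) 0) (f r) := by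
  have hts : 0 ≤ t - s := sub_nonneg.2 hst
  have hft := hf t (hs.trans hst)
  have hfs : IntervalIntegrable f volume 0 s := hf s hs
  have hfst : IntervalIntegrable f volume s t := hfs.symm.trans hft
  rw [hy t (hs.trans hst), hy s hs, map_sub, ← ContinuousLinearMap.comp_apply,
    ← hW.map_add _ _ hts hs, sub_add_cancel, sub_sub]
  congr 1
  rw [← intervalIntegral.integral_add_adjacent_intervals
    (hW.intervalIntegrable_apply hc hfs (c := fun r => t - r) (by fun_prop))
    (hW.intervalIntegrable_apply hc hfst (c := fun r => t - r) (by fun_prop)),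
    ← ContinuousLinearMap.intervalIntegral_comp_comm _
      (hW.intervalIntegrable_apply hc hfs (c := fun r => s - r) (by fun_prop))]
  congr 1
  refine intervalIntegral.integral_congr fun r hr => ?_
  rw [uIcc_of_le hs] at hr
  have h1 : 0 ≤ s - r := sub_nonneg.2 hr.2
  rw [max_eq_left h1, max_eq_left (sub_nonneg.2 (hr.2.trans hst)), ← ContinuousLinearMap.comp_apply,
    ← hW.map_add _ _ hts h1]
  congr 2; ring

/-- Fubini on the triangle `0 ≤ s ≤ t ≤ T`. -/
theorem IsC0Semigroup.integral_triangle_swap [CompleteSpace X] (hW : IsC0Semigroup W)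
    (hc : ∀ t, 0 ≤ t → ∀ x, ‖W t x‖ ≤ ‖x‖) {f : ℝ → X} {T : ℝ} (hT : 0 ≤ T)
    (hf : IntervalIntegrable f volume 0 T) :
    IntervalIntegrable (fun t => ∫ s in (0 : ℝ)..t, W (max (t - s) 0) (f s)) volume 0 T ∧
    IntervalIntegrable (fun s => ∫ r in (0 : ℝ)..(T - s), W (max r 0) (f s)) volume 0 T ∧
    ∫ t in (0 : ℝ)..T, ∫ s in (0 : ℝ)..t, W (max (t - s) 0) (f s)
      = ∫ s in (0 : ℝ)..T, ∫ r in (0 : ℝ)..(T - s), W (max r 0) (f s) := by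
  set μ : Measure ℝ := volume.restrict (Ioc 0 T) with hμ
  set G : ℝ → ℝ → X := fun t s => {p : ℝ × ℝ | p.2 ≤ p.1}.indicator
    (fun p => W (max (p.1 - p.2) 0) (f p.2)) (t, s) with hG
  have hfμ : Integrable f μ := (intervalIntegrable_iff_integrableOn_Ioc_of_le hT).1 hf
  have hmeas : MeasurableSet {p : ℝ × ℝ | p.2 ≤ p.1} :=
    measurableSet_le measurable_snd measurable_fst
  have hGi : Integrable (Function.uncurry G) (μ.prod μ) := by
    have h1 : Integrable (fun p : ℝ × ℝ => W (max (p.1 - p.2) 0) (f p.2)) (μ.prod μ) := by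
      have hf2 : Integrable (fun p : ℝ × ℝ => f p.2) (μ.prod μ) := hfμ.comp_snd μ
      refine hf2.mono ?_ ?_
      · exact (hW.continuous_uncurry_max hc).comp_aestronglyMeasurable
          (((measurable_fst.sub measurable_snd).aestronglyMeasurable).prodMk hf2.1)
      · exact Eventually.of_forall fun p => hc _ (le_max_right _ _) _
    exact h1.indicator hmeas
  have hleft : ∀ t ∈ Ioc 0 T, ∫ s, G t s ∂μ = ∫ s in (0 : ℝ)..t, W (max (t - s) 0) (f s) := by
    intro t ht
    have h1 : ∀ s, G t s = (Iic t).indicator (fun s => W (max (t - s) 0) (f s)) s := fun s => by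
      simp only [hG, indicator, mem_ofPred_eq, mem_Iic]
    simp_rw [h1]
    rw [integral_indicator measurableSet_Iic, hμ, Measure.restrict_restrict measurableSet_Iic,
      intervalIntegral.integral_of_le ht.1.le]
    congr 2
    ext s; constructor
    · rintro ⟨h, h'⟩; exact ⟨h'.1, h⟩
    · rintro ⟨h, h'⟩; exact ⟨h', h, h'.trans ht.2⟩
  have hright : ∀ s ∈ Ioc 0 T, ∫ t, G t s ∂μ = ∫ r in (0 : ℝ)..(T - s), W (max r 0) (f s) := by
    intro s hs
    have h1 : ∀ t, G t s = (Ici s).indicator (fun t => W (max (t - s) 0) (f s)) t := fun t => by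
      simp only [hG, indicator, mem_ofPred_eq, mem_Ici]
    simp_rw [h1]
    have h2 := intervalIntegral.integral_comp_sub_right (a := s) (b := T)
      (fun r => W (max r 0) (f s)) s
    rw [sub_self] at h2
    rw [← h2, integral_indicator measurableSet_Ici, hμ, Measure.restrict_restrict measurableSet_Ici,
      intervalIntegral.integral_of_le hs.2, ← integral_Icc_eq_integral_Ioc]
    congr 2
    ext t; constructor
    · rintro ⟨h, h'⟩; exact ⟨h, h'.2⟩
    · rintro ⟨h, h'⟩; exact ⟨h, hs.1.trans_le h, h'⟩
  have hae : ∀ {P : ℝ → Prop}, (∀ t ∈ Ioc 0 T, P t) → ∀ᵐ t ∂μ, P t := fun h =>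
    (ae_restrict_iff' measurableSet_Ioc).2 (Eventually.of_forall h)
  refine ⟨?_, ?_, ?_⟩
  · rw [intervalIntegrable_iff_integrableOn_Ioc_of_le hT]
    exact hGi.integral_prod_left.congr (hae hleft)
  · rw [intervalIntegrable_iff_integrableOn_Ioc_of_le hT]
    exact hGi.integral_prod_right.congr (hae hright)
  · rw [intervalIntegral.integral_of_le hT, intervalIntegral.integral_of_le hT,
      ← integral_congr_ae (hae hleft), ← integral_congr_ae (hae hright)]
    exact integral_integral_swap hGi

/-- A mild solution is an integrated solution: its time integral lies in the domain of the
generator. By Fubini, the Duhamel term integrates to `∫ s in 0..T, ∫ r in 0..(T - s), W r (f s)`, an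
integral of elements of the domain. -/
theorem IsMildSol.exists_generatorGraph [CompleteSpace X] (hW : IsC0Semigroup W)
    (hc : ∀ t, 0 ≤ t → ∀ x, ‖W t x‖ ≤ ‖x‖) {f : ℝ → X} {y₀ : X} {y : ℝ → X}
    (hf : ∀ T, 0 ≤ T → IntervalIntegrable f volume 0 T) (hy : IsMildSol W f y₀ y) {T : ℝ}
    (hT : 0 ≤ T) : ∃ z, GeneratorGraph W (∫ t in (0 : ℝ)..T, y t) z := by
  obtain ⟨h1, h2, h3⟩ := hW.integral_triangle_swap hc hT (hf T hT)
  have h4 : ∫ t in (0 : ℝ)..T, y t = (∫ t in (0 : ℝ)..T, W (max t 0) y₀)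
      - ∫ s in (0 : ℝ)..T, ∫ r in (0 : ℝ)..(T - s), W (max r 0) (f s) := by
    rw [← h3, ← intervalIntegral.integral_sub ((hW.continuous_max y₀).intervalIntegrable _ _) h1]
    refine intervalIntegral.integral_congr fun t ht => ?_
    rw [uIcc_of_le hT] at ht
    simp only [hy t ht.1, max_eq_left ht.1]
  have hz : IntervalIntegrable (fun s => W (max (T - s) 0) (f s) - f s) volume 0 T :=
    (hW.intervalIntegrable_apply hc (hf T hT) (c := fun s => T - s) (by fun_prop)).sub (hf T hT)
  rw [h4]
  refine ⟨_, (hW.generatorGraph_integral y₀ hT).sub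
    (hW.generatorGraph_intervalIntegral hc hT h2 hz fun s hs => ?_)⟩
  have h5 : 0 ≤ T - s := sub_nonneg.2 hs.2
  rw [max_eq_left h5]
  exact hW.generatorGraph_integral (f s) h5

end Mild

section Energy

variable {H : Type*} [NormedAddCommGroup H] [InnerProductSpace ℝ H] {W : ℝ → H →L[ℝ] H}

/-- One time step of the energy inequality, with `y` frozen at the right end point. -/
theorem IsMildSol.norm_sq_sub_le [CompleteSpace H] (hW : IsC0Semigroup W)
    (hc : ∀ t, 0 ≤ t → ∀ x, ‖W t x‖ ≤ ‖x‖) {f : ℝ → H} {y₀ : H} {y : ℝ → H}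
    (hf : ∀ T, 0 ≤ T → IntervalIntegrable f volume 0 T) (hy : IsMildSol W f y₀ y) {s t : ℝ}
    (hs : 0 ≤ s) (hst : s ≤ t) :
    ‖y t‖ ^ 2 - ‖y s‖ ^ 2 ≤ -2 * ∫ r in s..t, inner ℝ (y t) (W (max (t - r) 0) (f r)) := by
  have hfst : IntervalIntegrable f volume s t := (hf s hs).symm.trans (hf t (hs.trans hst))
  have h1 := hy.restart hW hc hf hs hst
  have hi : ∫ r in s..t, inner ℝ (y t) (W (max (t - r) 0) (f r))
      = inner ℝ (y t) (∫ r in s..t, W (max (t - r) 0) (f r)) :=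
    (innerSL ℝ (y t)).intervalIntegral_comp_comm
      (hW.intervalIntegrable_apply hc hfst (c := fun r => t - r) (by fun_prop))
  rw [hi]
  set g := ∫ r in s..t, W (max (t - r) 0) (f r)
  have h2 : y t + g = W (t - s) (y s) := by rw [h1]; abel
  have h3 : ‖y t + g‖ ≤ ‖y s‖ := by rw [h2]; exact hc _ (sub_nonneg.2 hst) _
  have h4 : ‖y t + g‖ ^ 2 ≤ ‖y s‖ ^ 2 := pow_le_pow_left₀ (norm_nonneg _) h3 2
  rw [norm_add_sq_real] at h4
  nlinarith [sq_nonneg ‖g‖]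

/-- **Energy inequality** for mild solutions. On each cell `(p i, p (i + 1)]` of a uniform partition
the inequality holds with `y` frozen at the right end point and `f` propagated to it; the sum over
the cells converges by dominated convergence. -/
theorem IsMildSol.energy_le [CompleteSpace H] (hW : IsC0Semigroup W)
    (hc : ∀ t, 0 ≤ t → ∀ x, ‖W t x‖ ≤ ‖x‖) {f : ℝ → H} {y₀ : H} {y : ℝ → H}
    (hf : ∀ T, 0 ≤ T → IntervalIntegrable f volume 0 T) (hy : IsMildSol W f y₀ y)
    (hyc : ContinuousOn y (Ici 0)) {s t : ℝ} (hs : 0 ≤ s) (hst : s ≤ t) :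
    ‖y t‖ ^ 2 ≤ ‖y s‖ ^ 2 - 2 * ∫ r in s..t, inner ℝ (y r) (f r) := by
  rcases hst.eq_or_lt with rfl | hlt
  · simp
  have hfst : IntervalIntegrable f volume s t := (hf s hs).symm.trans (hf t (hs.trans hst))
  set v : ℝ → H := fun r => y (max r 0) with hv
  have hvc : Continuous v := hyc.comp_continuous (by fun_prop) fun r => le_max_right r 0
  obtain ⟨C, hC⟩ := isCompact_Icc.exists_bound_of_continuousOn (hvc.continuousOn (s := Icc s t))
  -- the right end point of the cell that contains `r`
  set σ : ℕ → ℝ → ℝ := fun n r => s + ⌈(r - s) / ((t - s) / (n + 1))⌉₊ * ((t - s) / (n + 1)) with hσ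
  have hstep : ∀ n : ℕ, 0 < (t - s) / (n + 1) := fun n => div_pos (sub_pos.2 hlt) (by positivity)
  have hσ_ge : ∀ n r, r ≤ σ n r := by
    intro n r
    have := (div_le_iff₀ (hstep n)).1 (Nat.le_ceil ((r - s) / ((t - s) / ((n : ℝ) + 1))))
    simp only [hσ]; linarith
  have hσ_le : ∀ n r, s ≤ r → σ n r ≤ r + (t - s) / (n + 1) := by
    intro n r hr
    have h1 := (Nat.ceil_lt_add_one (div_nonneg (sub_nonneg.2 hr) (hstep n).le)).le
    have h2 := mul_le_mul_of_nonneg_right h1 (hstep n).le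
    rw [add_mul, div_mul_cancel₀ _ (hstep n).ne', one_mul] at h2
    simp only [hσ]; linarith
  have hσ_le_t : ∀ n, ∀ r ≤ t, σ n r ≤ t := by
    intro n r hr
    have h1 : ⌈(r - s) / ((t - s) / ((n : ℝ) + 1))⌉₊ ≤ n + 1 := by
      rw [Nat.ceil_le, div_le_iff₀ (hstep n)]
      push_cast
      rw [mul_div_cancel₀ _ (by positivity)]
      linarith
    have h2 : (⌈(r - s) / ((t - s) / ((n : ℝ) + 1))⌉₊ : ℝ) ≤ (n : ℝ) + 1 := by exact_mod_cast h1
    have h3 := mul_le_mul_of_nonneg_right h2 (hstep n).le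
    rw [mul_div_cancel₀ _ (by positivity)] at h3
    simp only [hσ]; linarith
  have hσm : ∀ n, Measurable (σ n) := fun n => by
    simp only [hσ]
    have h : Measurable fun r : ℝ => (⌈(r - s) / ((t - s) / ((n : ℝ) + 1))⌉₊ : ℝ) :=
      measurable_from_nat.comp (Nat.measurable_ceil.comp (by fun_prop))
    exact (h.mul_const _).const_add _
  have hσ_lim : ∀ r, s ≤ r → Tendsto (fun n => σ n r) atTop (𝓝 r) := by
    intro r hr
    have h0 : Tendsto (fun n : ℕ => r + (t - s) / ((n : ℝ) + 1)) atTop (𝓝 (r + 0)) :=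
      tendsto_const_nhds.add (tendsto_const_nhds.div_atTop
        (tendsto_natCast_atTop_atTop.atTop_add tendsto_const_nhds))
    rw [add_zero] at h0
    exact tendsto_of_tendsto_of_tendsto_of_le_of_le tendsto_const_nhds h0
      (fun n => hσ_ge n r) fun n => hσ_le n r hr
  set F : ℕ → ℝ → ℝ := fun n r => inner ℝ (v (σ n r)) (W (max (σ n r - r) 0) (f r)) with hF
  have hWi : ∀ n, IntervalIntegrable (fun r => W (max (σ n r - r) 0) (f r)) volume s t := fun n =>
    hW.intervalIntegrable_apply hc hfst ((hσm n).sub measurable_id)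
  have hFm : ∀ n, AEStronglyMeasurable (F n) (volume.restrict (uIoc s t)) := fun n =>
    AEStronglyMeasurable.inner
      (hvc.stronglyMeasurable.comp_measurable (hσm n)).aestronglyMeasurable
      (hWi n).aestronglyMeasurable_restrict_uIoc
  have hFb : ∀ n, ∀ r ∈ uIoc s t, ‖F n r‖ ≤ C * ‖f r‖ := by
    intro n r hr
    rw [uIoc_of_le hst] at hr
    refine (norm_inner_le_norm _ _).trans (mul_le_mul (hC _ ⟨hr.1.le.trans (hσ_ge n r),
      hσ_le_t n r hr.2⟩) (hc _ (le_max_right _ _) _) (norm_nonneg _) ?_)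
    exact (norm_nonneg _).trans (hC s ⟨le_rfl, hst⟩)
  have hFi : ∀ n, IntervalIntegrable (F n) volume s t := fun n =>
    (hfst.norm.const_mul C).mono_fun' (hFm n)
      ((ae_restrict_iff' measurableSet_uIoc).2 (Eventually.of_forall (hFb n)))
  have hlim : Tendsto (fun n => ∫ r in s..t, F n r) atTop (𝓝 (∫ r in s..t, inner ℝ (v r) (f r))) := by
    refine intervalIntegral.tendsto_integral_filter_of_dominated_convergence
      (fun r => C * ‖f r‖) (Eventually.of_forall hFm)
      (Eventually.of_forall fun n => Eventually.of_forall (hFb n)) (hfst.norm.const_mul C)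
      (Eventually.of_forall fun r hr => ?_)
    rw [uIoc_of_le hst] at hr
    have h1 := hσ_lim r hr.1.le
    have h2 : Tendsto (fun n => W (max (σ n r - r) 0) (f r)) atTop (𝓝 (f r)) := by
      have := ((hW.continuous_max (f r)).tendsto 0).comp
        (show Tendsto (fun n => σ n r - r) atTop (𝓝 0) by simpa using h1.sub_const r)
      simpa [Function.comp_def, hW.map_zero] using this
    exact ((hvc.tendsto r).comp h1).inner h2
  have hbound : ∀ n, ‖y t‖ ^ 2 - ‖y s‖ ^ 2 ≤ -2 * ∫ r in s..t, F n r := by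
    intro n
    set p : ℕ → ℝ := fun i => s + i * ((t - s) / (n + 1)) with hp
    have hpmono : Monotone p := fun i j hij => by
      have : (i : ℝ) ≤ j := by exact_mod_cast hij
      simp only [hp]
      nlinarith [hstep n]
    have hp0 : p 0 = s := by simp [hp]
    have hpn : p (n + 1) = t := by
      simp only [hp]; push_cast; rw [mul_div_cancel₀ _ (by positivity)]; ring
    have hcell : ∀ i < n + 1, ‖y (p (i + 1))‖ ^ 2 - ‖y (p i)‖ ^ 2
        ≤ -2 * ∫ r in p i..p (i + 1), F n r := by
      intro i _
      have hpi : 0 ≤ p i := hs.trans (hp0 ▸ hpmono (Nat.zero_le i))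
      refine (hy.norm_sq_sub_le hW hc hf hpi (hpmono i.le_succ)).trans_eq ?_
      congr 1
      refine intervalIntegral.integral_congr_uIoo fun r hr => ?_
      rw [uIoo_of_le (hpmono i.le_succ)] at hr
      have h1 : σ n r = p (i + 1) := by
        simp only [hσ, hp]
        congr 3
        rw [Nat.ceil_eq_iff (Nat.succ_ne_zero i), lt_div_iff₀ (hstep n), div_le_iff₀ (hstep n)]
        have h2 := hr.1
        have h3 := hr.2
        simp only [hp] at h2 h3
        push_cast at h3 ⊢
        constructor <;> linarith
      simp only [hF, h1, hv, max_eq_left (hpi.trans (hpmono i.le_succ))]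
    have hsum := Finset.sum_le_sum fun i hi => hcell i (Finset.mem_range.1 hi)
    rw [Finset.sum_range_sub (fun i => ‖y (p i)‖ ^ 2), ← Finset.mul_sum,
      intervalIntegral.sum_integral_adjacent_intervals, hp0, hpn] at hsum
    · exact hsum
    · intro i hi
      refine (hFi n).mono_set ?_
      rw [uIcc_of_le (hpmono i.le_succ), uIcc_of_le hst]
      exact Icc_subset_Icc (hp0 ▸ hpmono (Nat.zero_le i)) (hpn ▸ hpmono hi)
  have hfin := ge_of_tendsto' (hlim.const_mul (-2)) hbound
  have heq : ∫ r in s..t, inner ℝ (v r) (f r) = ∫ r in s..t, inner ℝ (y r) (f r) := by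
    refine intervalIntegral.integral_congr fun r hr => ?_
    rw [uIcc_of_le hst] at hr
    simp only [hv, max_eq_left (hs.trans hr.1)]
  rw [heq] at hfin
  linarith

end Energy

/-! ### Absolutely continuous functions on `[0, L]` -/

/-- `f` is absolutely continuous on `[0, L]` and its almost everywhere derivative is `v`. -/
def HasACDeriv (L : ℝ) (f v : ℝ → ℝ) : Prop :=
  AbsolutelyContinuousOnInterval f 0 L ∧
    ∀ᵐ x ∂(volume.restrict (Ioo (0 : ℝ) L)), HasDerivAt f (v x) x

namespace HasACDeriv

variable {L : ℝ} {f g v u : ℝ → ℝ}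

theorem integral (hL : 0 < L) (h : HasACDeriv L f v) : ∫ x in Ioo 0 L, v x = f L - f 0 := by
  rw [← h.1.integral_deriv_eq_sub, intervalIntegral.integral_of_le hL.le,
    integral_Ioc_eq_integral_Ioo]
  refine integral_congr_ae ?_
  filter_upwards [h.2] with x hx using hx.deriv.symm

theorem mul (hf : HasACDeriv L f v) (hg : HasACDeriv L g u) :
    HasACDeriv L (fun x => f x * g x) (fun x => v x * g x + f x * u x) := by
  refine ⟨hf.1.fun_mul hg.1, ?_⟩
  filter_upwards [hf.2, hg.2] with x h1 h2 using h1.mul h2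

theorem add_const (hf : HasACDeriv L f v) (c : ℝ) : HasACDeriv L (fun x => f x + c) v := by
  refine ⟨hf.1.fun_add ?_, ?_⟩
  · exact (contDiff_const (n := 1)).contDiffOn.absolutelyContinuousOnInterval
  · filter_upwards [hf.2] with x h using h.add_const c

theorem of_contDiff (hf : ContDiff ℝ ∞ f) : HasACDeriv L f (deriv f) :=
  ⟨(hf.of_le (by exact_mod_cast le_top)).contDiffOn.absolutelyContinuousOnInterval,
    Eventually.of_forall fun x => (hf.differentiable (by simp) x).hasDerivAt⟩

theorem continuousOn (hL : 0 < L) (hf : HasACDeriv L f v) : ContinuousOn f (Icc 0 L) := by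
  simpa [uIcc_of_le hL.le] using hf.1.continuousOn

end HasACDeriv

/-! ### The primitive operator -/

theorem integrableOn_L2 {L : ℝ} (v : L2 L) : IntegrableOn v (Ioo 0 L) :=
  (Lp.memLp v).integrable (by norm_num)

/-- The primitive of `v ∈ L²(0,L)` that vanishes at `0`; `v` is extended by zero, so that the
primitive is a bounded continuous function on the whole line. -/
noncomputable def prim {L : ℝ} (v : L2 L) (x : ℝ) : ℝ := ∫ t in (0 : ℝ)..x, (Ioo 0 L).indicator v t

theorem integrable_indicator_L2 {L : ℝ} (v : L2 L) : Integrable ((Ioo 0 L).indicator v) :=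
  (integrable_indicator_iff measurableSet_Ioo).2 (integrableOn_L2 v)

theorem continuous_prim {L : ℝ} (v : L2 L) : Continuous (prim v) :=
  intervalIntegral.continuous_primitive
    (fun _ _ => (integrable_indicator_L2 v).intervalIntegrable) 0

theorem prim_zero {L : ℝ} (v : L2 L) : prim v 0 = 0 := by simp [prim]

theorem hasACDeriv_prim {L : ℝ} (v : L2 L) : HasACDeriv L (prim v) v := by
  refine ⟨((integrable_indicator_L2 v).intervalIntegrable).absolutelyContinuousOnInterval_intervalIntegral
    left_mem_uIcc, ?_⟩
  have h := LocallyIntegrable.ae_hasDerivAt_integral (integrable_indicator_L2 v).locallyIntegrable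
  filter_upwards [ae_restrict_of_ae h, ae_restrict_mem measurableSet_Ioo] with x hx hx'
  simpa [indicator_of_mem hx'] using! hx 0

theorem prim_right {L : ℝ} (hL : 0 < L) (v : L2 L) : prim v L = ∫ x in Ioo 0 L, v x := by
  rw [(hasACDeriv_prim v).integral hL, prim_zero, sub_zero]

theorem indicator_congr_L2 {L : ℝ} {f g : ℝ → ℝ} (h : f =ᵐ[volume.restrict (Ioo 0 L)] g) :
    (Ioo 0 L).indicator f =ᵐ[volume] (Ioo 0 L).indicator g :=
  (ae_eq_restrict_iff_indicator_ae_eq measurableSet_Ioo).1 h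

theorem prim_add {L : ℝ} (v w : L2 L) (x : ℝ) : prim (v + w) x = prim v x + prim w x := by
  simp only [prim]
  rw [← intervalIntegral.integral_add (integrable_indicator_L2 v).intervalIntegrable
    (integrable_indicator_L2 w).intervalIntegrable]
  refine intervalIntegral.integral_congr_ae ?_
  filter_upwards [indicator_congr_L2 (Lp.coeFn_add v w)] with t ht _
  rw [ht, indicator_add']; rfl

theorem prim_smul {L : ℝ} (c : ℝ) (v : L2 L) (x : ℝ) : prim (c • v) x = c * prim v x := by
  simp only [prim]
  rw [← intervalIntegral.integral_const_mul]
  refine intervalIntegral.integral_congr_ae ?_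
  filter_upwards [indicator_congr_L2 (Lp.coeFn_smul c v)] with t ht _
  rw [ht]
  exact indicator_const_smul_apply _ c v t

theorem abs_prim_le {L : ℝ} (v : L2 L) (x : ℝ) :
    ‖prim v x‖ ≤ (volume.restrict (Ioo 0 L) univ ^ (1 / (1 : ℝ≥0∞).toReal - 1 / (2 : ℝ≥0∞).toReal)).toReal
      * ‖v‖ := by
  have h1 : ‖prim v x‖ ≤ ∫ t in Ioo 0 L, ‖v t‖ := by
    refine intervalIntegral.norm_integral_le_integral_norm_uIoc.trans ?_
    rw [← integral_indicator measurableSet_Ioo]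
    simp_rw [norm_indicator_eq_indicator_norm]
    have hi := (integrable_indicator_L2 v).norm
    simp_rw [norm_indicator_eq_indicator_norm] at hi
    exact setIntegral_le_integral hi
      (Eventually.of_forall fun t => indicator_nonneg (fun _ _ => norm_nonneg _) t)
  refine h1.trans ?_
  have h2 := eLpNorm_le_eLpNorm_mul_rpow_measure_univ (p := 1) (q := 2) (by norm_num)
    (Lp.aestronglyMeasurable v)
  rw [integral_norm_eq_lintegral_enorm (Lp.aestronglyMeasurable v), ← eLpNorm_one_eq_lintegral_enorm,
    mul_comm, Lp.norm_def, ← ENNReal.toReal_mul]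
  refine ENNReal.toReal_mono (ENNReal.mul_ne_top (Lp.eLpNorm_ne_top v) ?_) h2
  exact ENNReal.rpow_ne_top_of_nonneg (by norm_num) (measure_ne_top _ _)

/-- `prim` as a bounded operator from `L²(0,L)` to bounded continuous functions. -/
noncomputable def primL (L : ℝ) : L2 L →L[ℝ] BoundedContinuousFunction ℝ ℝ :=
  LinearMap.mkContinuous
    { toFun := fun v => BoundedContinuousFunction.ofNormedAddCommGroup (prim v) (continuous_prim v) _
        (abs_prim_le v)
      map_add' := fun v w => by ext x; exact prim_add v w x
      map_smul' := fun c v => by ext x; exact prim_smul c v x }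
    _ fun v => BoundedContinuousFunction.norm_ofNormedAddCommGroup_le _
      (mul_nonneg ENNReal.toReal_nonneg (norm_nonneg _)) (abs_prim_le v)

@[simp] theorem primL_apply {L : ℝ} (v : L2 L) (x : ℝ) : primL L v x = prim v x := rfl

/-! ### The fundamental lemma of the calculus of variations, for derivatives -/

theorem exists_Icc_subset_of_isCompact {L : ℝ} {K : Set ℝ} (hK : IsCompact K) (hne : K.Nonempty)
    (hKL : K ⊆ Ioo 0 L) : ∃ a b, 0 < a ∧ b < L ∧ K ⊆ Icc a b := by
  obtain ⟨a, ha⟩ := hK.exists_isLeast hne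
  obtain ⟨b, hb⟩ := hK.exists_isGreatest hne
  exact ⟨a, b, (hKL ha.1).1, (hKL hb.1).2, fun x hx => ⟨ha.2 hx, hb.2 hx⟩⟩

/-- A test function on `(0, L)` with zero mean is the derivative of a test function. -/
theorem exists_test_primitive {L : ℝ} {χ : ℝ → ℝ} (hχ : ContDiff ℝ ∞ χ) {a b : ℝ} (ha : 0 < a)
    (hb : b < L) (hs : ∀ x, x ∉ Icc a b → χ x = 0) (hint : ∫ x, χ x = 0) :
    ∃ φ : ℝ → ℝ, ContDiff ℝ ∞ φ ∧ HasCompactSupport φ ∧ tsupport φ ⊆ Ioo 0 L ∧ deriv φ = χ := by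
  have hd : ∀ x, HasDerivAt (fun x => ∫ t in (0 : ℝ)..x, χ t) (χ x) x := fun x =>
    intervalIntegral.integral_hasDerivAt_right (hχ.continuous.intervalIntegrable _ _)
      hχ.continuous.stronglyMeasurable.stronglyMeasurableAtFilter hχ.continuous.continuousAt
  have hderiv : deriv (fun x => ∫ t in (0 : ℝ)..x, χ t) = χ := funext fun x => (hd x).deriv
  have hsupp : Function.support (fun x => ∫ t in (0 : ℝ)..x, χ t) ⊆ Icc a b := by
    intro x hx
    by_contra hxn
    apply hx
    by_cases hxa : x < a
    · refine (intervalIntegral.integral_congr fun t ht => ?_).trans intervalIntegral.integral_zero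
      exact hs t fun h => absurd (h.1.trans ht.2) (not_le.2 (max_lt ha hxa))
    · have hbx : b < x := not_le.1 fun h => hxn ⟨not_lt.1 hxa, h⟩
      change ∫ t in (0 : ℝ)..x, χ t = 0
      rw [intervalIntegral.integral_eq_integral_of_support_subset, hint]
      intro t ht
      have : t ∈ Icc a b := by
        by_contra h
        exact ht (hs t h)
      exact ⟨ha.trans_le this.1, this.2.trans hbx.le⟩
  have hts := closure_minimal hsupp isClosed_Icc
  refine ⟨_, ?_, HasCompactSupport.of_support_subset_isCompact isCompact_Icc hsupp,
    hts.trans (Icc_subset_Ioo ha hb), hderiv⟩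
  rw [contDiff_infty_iff_deriv, hderiv]
  exact ⟨fun x => (hd x).differentiableAt, hχ⟩

/-- A function with vanishing weak derivative is constant. -/
theorem ae_eq_const_of_integral_mul_deriv {L : ℝ} (hL : 0 < L) {d : ℝ → ℝ}
    (hd : IntegrableOn d (Ioo 0 L))
    (h : ∀ φ : ℝ → ℝ, ContDiff ℝ ∞ φ → HasCompactSupport φ → tsupport φ ⊆ Ioo 0 L →
      ∫ x in Ioo 0 L, d x * deriv φ x = 0) :
    ∃ c : ℝ, d =ᵐ[volume.restrict (Ioo 0 L)] fun _ => c := by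
  obtain ⟨ρ₀, hρs, hρc, hρd, hρr, hρ1⟩ := exists_contDiff_tsupport_subset (n := ⊤)
    (show Ioo 0 L ∈ 𝓝 (L / 2) from Ioo_mem_nhds (by linarith) (by linarith))
  have hI : 0 < ∫ x, ρ₀ x := hρd.continuous.integral_pos_of_hasCompactSupport_nonneg_nonzero hρc
    (fun x => (hρr ⟨x, rfl⟩).1) (x := L / 2) (by rw [hρ1]; norm_num)
  set m := ∫ x, ρ₀ x
  refine ⟨(∫ x in Ioo 0 L, d x * ρ₀ x) / m, ?_⟩
  set c := (∫ x in Ioo 0 L, d x * ρ₀ x) / m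
  have hint : ∀ g : ℝ → ℝ, Continuous g → HasCompactSupport g →
      IntegrableOn (fun x => d x * g x) (Ioo 0 L) := fun g hg hgc => by
    obtain ⟨C, hC⟩ := hg.bounded_above_of_compact_support hgc
    exact hd.mul_bdd hg.aestronglyMeasurable (Eventually.of_forall hC)
  have key := isOpen_Ioo.ae_eq_zero_of_integral_contDiff_smul_eq_zero (U := Ioo 0 L) (μ := volume)
    (f := fun x => d x - c) ((hd.sub (integrableOn_const (by simp))).locallyIntegrableOn) ?_
  · rw [EventuallyEq, ae_restrict_iff' measurableSet_Ioo]
    filter_upwards [key] with x hx hx'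
    linarith [hx hx']
  intro ψ hψ hψc hψs
  have hr : ∫ x, ψ x • (d x - c) = ∫ x in Ioo 0 L, (d x * ψ x - c * ψ x) := by
    rw [← setIntegral_eq_integral_of_forall_compl_eq_zero (s := Ioo 0 L)]
    · congr 1; ext x; simp only [smul_eq_mul]; ring
    · intro x hx
      rw [image_eq_zero_of_notMem_tsupport fun h => hx (hψs h), zero_smul]
  have hψI : ∫ x in Ioo 0 L, ψ x = ∫ x, ψ x :=
    setIntegral_eq_integral_of_forall_compl_eq_zero fun x hx =>
      image_eq_zero_of_notMem_tsupport fun h => hx (hψs h)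
  have hψi : Integrable ψ := hψ.continuous.integrable_of_hasCompactSupport hψc
  have hρi : Integrable ρ₀ := hρd.continuous.integrable_of_hasCompactSupport hρc
  -- subtract a multiple of the bump function to make the mean value vanish
  set k := (∫ x, ψ x) / m with hk
  obtain ⟨a, b, ha, hb, hab⟩ := exists_Icc_subset_of_isCompact (hψc.isCompact.union hρc.isCompact)
    ⟨L / 2, Or.inr (subset_tsupport _ (by simp [hρ1]))⟩ (union_subset hψs hρs)
  obtain ⟨φ, h1, h2, h3, h4⟩ := exists_test_primitive (χ := fun x => ψ x - k * ρ₀ x)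
    (hψ.sub (contDiff_const.mul hρd)) ha hb
    (fun x hx => by
      rw [image_eq_zero_of_notMem_tsupport fun h => hx (hab (Or.inl h)),
        image_eq_zero_of_notMem_tsupport fun h => hx (hab (Or.inr h))]; ring)
    (by
      rw [integral_sub hψi (hρi.const_mul k), integral_const_mul, hk, div_mul_cancel₀ _ hI.ne',
        sub_self])
  have h5 := h φ h1 h2 h3
  rw [h4] at h5
  have h6 : ∫ x in Ioo 0 L, d x * (ψ x - k * ρ₀ x)
      = (∫ x in Ioo 0 L, d x * ψ x) - k * ∫ x in Ioo 0 L, d x * ρ₀ x := by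
    rw [← integral_const_mul, ← integral_sub (hint ψ hψ.continuous hψc)
      ((hint ρ₀ hρd.continuous hρc).const_mul k)]
    congr 1; ext x; ring
  rw [hr, integral_sub (hint ψ hψ.continuous hψc) (hψi.integrableOn.const_mul c), integral_const_mul,
    hψI]
  have h7 : c * ∫ x, ψ x = k * ∫ x in Ioo 0 L, d x * ρ₀ x := by
    simp only [c, k]; ring
  rw [h7, ← h6, h5]

/-! ### Functions in `H¹(0, L)` and their boundary values -/

theorem HasWeakDeriv.exists_ae_eq {L : ℝ} (hL : 0 < L) {w v : L2 L} (h : HasWeakDeriv L w v) :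
    ∃ c : ℝ, w =ᵐ[volume.restrict (Ioo 0 L)] fun x => prim v x + c := by
  have hpi : IntegrableOn (prim v) (Ioo 0 L) :=
    ((continuous_prim v).continuousOn.integrableOn_Icc (a := 0) (b := L)).mono_set Ioo_subset_Icc_self
  obtain ⟨c, hc⟩ := ae_eq_const_of_integral_mul_deriv hL ((integrableOn_L2 w).sub hpi) fun φ h1 h2 h3 => by
    have hφ0 : φ 0 = 0 := image_eq_zero_of_notMem_tsupport fun h => lt_irrefl _ (h3 h).1
    have hφL : φ L = 0 := image_eq_zero_of_notMem_tsupport fun h => lt_irrefl _ (h3 h).2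
    have h4 := ((hasACDeriv_prim v).mul (HasACDeriv.of_contDiff (L := L) h1)).integral hL
    rw [hφ0, hφL, mul_zero, mul_zero, sub_zero] at h4
    have hcd := h1.continuous_deriv (by simp)
    obtain ⟨C, hC⟩ := hcd.bounded_above_of_compact_support h2.deriv
    obtain ⟨C', hC'⟩ := h1.continuous.bounded_above_of_compact_support h2
    have i1 : IntegrableOn (fun x => w x * deriv φ x) (Ioo 0 L) :=
      (integrableOn_L2 w).mul_bdd hcd.aestronglyMeasurable (Eventually.of_forall hC)
    have i2 : IntegrableOn (fun x => prim v x * deriv φ x) (Ioo 0 L) :=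
      hpi.mul_bdd hcd.aestronglyMeasurable (Eventually.of_forall hC)
    have i3 : IntegrableOn (fun x => v x * φ x) (Ioo 0 L) :=
      (integrableOn_L2 v).mul_bdd h1.continuous.aestronglyMeasurable (Eventually.of_forall hC')
    rw [integral_add i3 i2] at h4
    have h5 := h φ h1 h2 h3
    simp only [Pi.sub_apply, sub_mul]
    rw [integral_sub i1 i2]
    linarith
  refine ⟨c, ?_⟩
  filter_upwards [hc] with x hx
  simp only [Pi.sub_apply] at hx
  linarith

theorem HasValueAt.eq_of_ae_eq {L : ℝ} (hL : 0 < L) {w : L2 L} {x c : ℝ} (h : HasValueAt L w x c)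
    (hx : x ∈ Icc 0 L) {f : ℝ → ℝ} (hf : ContinuousOn f (Icc 0 L))
    (hwf : w =ᵐ[volume.restrict (Ioo 0 L)] f) : f x = c := by
  obtain ⟨g, hg, hwg, rfl⟩ := h
  refine Measure.eqOn_Icc_of_ae_eq volume hL.ne ?_ hf hg hx
  rw [Measure.restrict_congr_set Ioo_ae_eq_Icc.symm]
  exact hwf.symm.trans hwg

/-- An element of `H¹(0, L)` has an absolutely continuous representative. -/
theorem HasWeakDeriv.exists_hasACDeriv {L : ℝ} (hL : 0 < L) {w v : L2 L} (h : HasWeakDeriv L w v) :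
    ∃ f, HasACDeriv L f v ∧ w =ᵐ[volume.restrict (Ioo 0 L)] f := by
  obtain ⟨c, hc⟩ := h.exists_ae_eq hL
  exact ⟨_, (hasACDeriv_prim v).add_const c, hc⟩

/-! ### Dissipativity of the linear KdV operator -/

theorem memLp_mul_L2 {L : ℝ} {f : ℝ → ℝ} (hf : ContinuousOn f (Icc 0 L)) (v : L2 L) :
    MemLp (fun x => f x * v x) 2 (volume.restrict (Ioo 0 L)) := by
  obtain ⟨C, hC⟩ := isCompact_Icc.exists_bound_of_continuousOn hf
  refine MemLp.of_le_mul (c := C) (Lp.memLp v) ?_ ?_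
  · exact ((hf.mono Ioo_subset_Icc_self).aestronglyMeasurable measurableSet_Ioo).mul
      (Lp.aestronglyMeasurable v)
  · filter_upwards [ae_restrict_mem measurableSet_Ioo] with x hx
    rw [norm_mul]
    exact mul_le_mul_of_nonneg_right (hC x (Ioo_subset_Icc_self hx)) (norm_nonneg _)

theorem integrable_mul_L2 {L : ℝ} {f : ℝ → ℝ} (hf : ContinuousOn f (Icc 0 L))
    (v : L2 L) : Integrable (fun x => f x * v x) (volume.restrict (Ioo 0 L)) :=
  (memLp_mul_L2 hf v).integrable (by norm_num)

/-- The linear KdV operator `A` is dissipative: `⟨A w, w⟩ = -w'(0)² / 2` for `w` in its domain. -/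
theorem KdVOperatorGraph.inner_nonpos {L : ℝ} (hL : 0 < L) {w z : L2 L}
    (h : KdVOperatorGraph L w z) : inner ℝ w z ≤ 0 := by
  obtain ⟨w₁, w₂, w₃, h1, h2, h3, hv0, hvL, hv1, rfl⟩ := h
  obtain ⟨f, hf, hwf⟩ := h1.exists_hasACDeriv hL
  obtain ⟨f₁, hf₁, hwf₁⟩ := h2.exists_hasACDeriv hL
  obtain ⟨f₂, hf₂, hwf₂⟩ := h3.exists_hasACDeriv hL
  have e0 := hv0.eq_of_ae_eq hL ⟨le_rfl, hL.le⟩ (hf.continuousOn hL) hwf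
  have eL := hvL.eq_of_ae_eq hL ⟨hL.le, le_rfl⟩ (hf.continuousOn hL) hwf
  have e1 := hv1.eq_of_ae_eq hL ⟨hL.le, le_rfl⟩ (hf₁.continuousOn hL) hwf₁
  have cf := hf.continuousOn hL
  have cf₁ := hf₁.continuousOn hL
  -- the three integrations by parts: `(w²)'`, `(w w'')'` and `((w')²)'`
  have i1 := (hf.mul hf).integral hL
  have i2 := (hf.mul hf₂).integral hL
  have i3 := (hf₁.mul hf₁).integral hL
  have a1 : ∫ x in Ioo 0 L, (w₁ x * f x + f x * w₁ x) = 2 * ∫ x in Ioo 0 L, f x * w₁ x := by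
    rw [← integral_const_mul]; congr 1; ext x; ring
  have a2 : ∫ x in Ioo 0 L, (w₁ x * f₂ x + f x * w₃ x)
      = (∫ x in Ioo 0 L, f₁ x * w₂ x) + ∫ x in Ioo 0 L, f x * w₃ x := by
    rw [← integral_add (integrable_mul_L2 cf₁ w₂) (integrable_mul_L2 cf w₃)]
    refine integral_congr_ae ?_
    filter_upwards [hwf₁, hwf₂] with x hx1 hx2
    rw [hx1, hx2]
  have a3 : ∫ x in Ioo 0 L, (w₂ x * f₁ x + f₁ x * w₂ x) = 2 * ∫ x in Ioo 0 L, f₁ x * w₂ x := by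
    rw [← integral_const_mul]; congr 1; ext x; ring
  have a4 : inner ℝ w (-w₁ - w₃)
      = -((∫ x in Ioo 0 L, f x * w₁ x) + ∫ x in Ioo 0 L, f x * w₃ x) := by
    rw [L2.inner_def, ← integral_add (integrable_mul_L2 cf w₁)
      (integrable_mul_L2 cf w₃), ← integral_neg]
    refine integral_congr_ae ?_
    filter_upwards [hwf, Lp.coeFn_sub (-w₁) w₃, Lp.coeFn_neg w₁] with x hx h4 h5
    rw [h4, Pi.sub_apply, h5, hx]
    simp only [RCLike.inner_apply, conj_trivial, Pi.neg_apply]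
    ring
  rw [a1] at i1
  rw [a2] at i2
  rw [a3] at i3
  rw [a4]
  rw [e0, eL] at i1 i2
  rw [e1] at i3
  nlinarith [sq_nonneg (f₁ 0)]

/-! ### Traces and the nonlinear term -/

/-- The value at `0` of `w ∈ H¹(0,L)` as a bounded functional of the pair `(w, w')`: it is the mean
value over `(0,L)` of the constant function `w - prim w'`. -/
noncomputable def traceZero (L : ℝ) : L2 L × L2 L →L[ℝ] ℝ :=
  L⁻¹ • (BoundedContinuousFunction.evalCLM ℝ L).comp ((primL L).comp
    (ContinuousLinearMap.fst ℝ _ _ - ((BoundedContinuousFunction.toLp 2 (volume.restrict (Ioo 0 L)) ℝ).comp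
      (primL L)).comp (ContinuousLinearMap.snd ℝ _ _)))

/-- The value at `L` of `w ∈ H¹(0,L)` as a bounded functional of the pair `(w, w')`. -/
noncomputable def traceRight (L : ℝ) : L2 L × L2 L →L[ℝ] ℝ :=
  traceZero L + (BoundedContinuousFunction.evalCLM ℝ L).comp
    ((primL L).comp (ContinuousLinearMap.snd ℝ _ _))

theorem traceRight_apply {L : ℝ} (w v : L2 L) : traceRight L (w, v) = traceZero L (w, v) + prim v L :=
  rfl

/-- The continuous representative of an element of `H¹(0, L)`, with its constant of integration
expressed by the trace. -/
theorem HasWeakDeriv.ae_eq {L : ℝ} (hL : 0 < L) {w v : L2 L} (h : HasWeakDeriv L w v) :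
    w =ᵐ[volume.restrict (Ioo 0 L)] fun x => prim v x + traceZero L (w, v) := by
  obtain ⟨c, hc⟩ := h.exists_ae_eq hL
  have hval : traceZero L (w, v) = c := by
    have h1 : traceZero L (w, v) = L⁻¹ * prim (w - BoundedContinuousFunction.toLp 2
        (volume.restrict (Ioo 0 L)) ℝ (primL L v)) L := rfl
    rw [h1, prim_right hL]
    have h2 : ∀ᵐ x ∂(volume.restrict (Ioo 0 L)), (w - BoundedContinuousFunction.toLp 2
        (volume.restrict (Ioo 0 L)) ℝ (primL L v) : L2 L) x = c := by
      filter_upwards [hc, Lp.coeFn_sub w (BoundedContinuousFunction.toLp 2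
        (volume.restrict (Ioo 0 L)) ℝ (primL L v)), BoundedContinuousFunction.coeFn_toLp 2
        (volume.restrict (Ioo 0 L)) ℝ (primL L v)] with x h3 h4 h5
      rw [h4, Pi.sub_apply, h3, h5, primL_apply]; ring
    rw [integral_congr_ae h2]
    simp [hL.le, hL.ne']
  rw [hval]
  exact hc

theorem HasWeakDeriv.traceZero_eq {L : ℝ} (hL : 0 < L) {w v : L2 L} (h : HasWeakDeriv L w v) {c : ℝ}
    (hw : HasValueAt L w 0 c) : traceZero L (w, v) = c := by
  have := hw.eq_of_ae_eq hL ⟨le_rfl, hL.le⟩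
    ((continuous_prim v).add continuous_const).continuousOn (h.ae_eq hL)
  simpa [prim_zero] using this

theorem HasWeakDeriv.traceRight_eq {L : ℝ} (hL : 0 < L) {w v : L2 L} (h : HasWeakDeriv L w v) {c : ℝ}
    (hw : HasValueAt L w L c) : traceRight L (w, v) = c := by
  have := hw.eq_of_ae_eq hL ⟨hL.le, le_rfl⟩
    ((continuous_prim v).add continuous_const).continuousOn (h.ae_eq hL)
  rw [traceRight_apply, add_comm]
  exact this

/-- The bounded bilinear map `((w, v), u) ↦ w u`, for `w ∈ H¹(0,L)` with weak derivative `v`. -/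
noncomputable def mulH1 (L : ℝ) : L2 L × L2 L →L[ℝ] L2 L →L[ℝ] L2 L :=
  ((ContinuousLinearMap.mul ℝ ℝ).holderL (volume.restrict (Ioo 0 L)) ∞ 2 2).comp
    ((BoundedContinuousFunction.toLp ∞ (volume.restrict (Ioo 0 L)) ℝ).comp
      ((primL L).comp (ContinuousLinearMap.snd ℝ _ _)
        + (traceZero L).smulRight (BoundedContinuousFunction.const ℝ (1 : ℝ))))

theorem HasWeakDeriv.mulL2_ae_eq {L : ℝ} (hL : 0 < L) {w v : L2 L} (h : HasWeakDeriv L w v) (u : L2 L) :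
    mulL2 w u =ᵐ[volume.restrict (Ioo 0 L)] fun x => w x * u x := by
  have hm : MemLp (fun x => w x * u x) 2 (volume.restrict (Ioo 0 L)) := by
    refine (memLp_mul_L2 (f := fun x => prim v x + traceZero L (w, v))
      ((continuous_prim v).add continuous_const).continuousOn u).ae_eq ?_
    filter_upwards [h.ae_eq hL] with x hx
    rw [hx]
  rw [mulL2, dif_pos hm]
  exact hm.coeFn_toLp

/-- On `H¹(0, L)` the product is given by a bounded bilinear map. This is what makes
`t ↦ y(t) y_x(t)` strongly measurable and locally integrable. -/
theorem HasWeakDeriv.mulL2_eq {L : ℝ} (hL : 0 < L) {w v : L2 L} (h : HasWeakDeriv L w v) (u : L2 L) :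
    mulL2 w u = mulH1 L (w, v) u := by
  refine Lp.ext ?_
  set g := primL L v + traceZero L (w, v) • BoundedContinuousFunction.const ℝ (1 : ℝ) with hg
  have h1 : mulH1 L (w, v) u = (ContinuousLinearMap.mul ℝ ℝ).holder 2
    (BoundedContinuousFunction.toLp ∞ (volume.restrict (Ioo 0 L)) ℝ g) u := rfl
  rw [h1]
  filter_upwards [h.mulL2_ae_eq hL u, h.ae_eq hL, (ContinuousLinearMap.mul ℝ ℝ).coeFn_holder (r := 2)
    (BoundedContinuousFunction.toLp ∞ (volume.restrict (Ioo 0 L)) ℝ g) u,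
    BoundedContinuousFunction.coeFn_toLp ∞ (volume.restrict (Ioo 0 L)) ℝ g] with x h2 h3 h4 h5
  rw [h2, h4, h5, h3]
  simp [hg]
  ring

/-- `∫ w² w' = [w³ / 3] = 0` if `w` vanishes at both ends. -/
theorem HasWeakDeriv.inner_mulL2_eq_zero {L : ℝ} (hL : 0 < L) {w v : L2 L} (h : HasWeakDeriv L w v)
    (h0 : traceZero L (w, v) = 0) (h1 : traceRight L (w, v) = 0) : inner ℝ w (mulL2 w v) = 0 := by
  have hw := h.ae_eq hL
  rw [h0] at hw
  rw [traceRight_apply, h0, zero_add] at h1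
  have hp := hasACDeriv_prim v
  have h2 := ((hp.mul hp).mul hp).integral hL
  simp only [h1, prim_zero, mul_zero, sub_zero] at h2
  have h3 : inner ℝ w (mulL2 w v) = 3⁻¹ * ∫ x in Ioo 0 L, ((v x * prim v x + prim v x * v x) * prim v x
      + prim v x * prim v x * v x) := by
    rw [L2.inner_def, ← integral_const_mul]
    refine integral_congr_ae ?_
    filter_upwards [hw, h.mulL2_ae_eq hL v] with x hx hx'
    rw [hx', hx]
    simp only [RCLike.inner_apply, conj_trivial]
    ring
  rw [h3, h2, mul_zero]

/-- Weak differentiation commutes with Bochner integrals. -/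
theorem hasWeakDeriv_intervalIntegral {L : ℝ} {y v : ℝ → L2 L} {T : ℝ} (hT : 0 ≤ T)
    (hy : IntervalIntegrable y volume 0 T) (hv : IntervalIntegrable v volume 0 T)
    (h : ∀ᵐ t ∂(volume.restrict (Ioi (0 : ℝ))), HasWeakDeriv L (y t) (v t)) :
    HasWeakDeriv L (∫ t in (0 : ℝ)..T, y t) (∫ t in (0 : ℝ)..T, v t) := by
  intro φ h1 h2 h3
  have hcd := h1.continuous_deriv (by simp)
  have m1 : MemLp (deriv φ) 2 (volume.restrict (Ioo 0 L)) :=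
    (hcd.memLp_of_hasCompactSupport h2.deriv).restrict _
  have m2 : MemLp φ 2 (volume.restrict (Ioo 0 L)) :=
    (h1.continuous.memLp_of_hasCompactSupport h2).restrict _
  have hin : ∀ {g : ℝ → ℝ} (hg : MemLp g 2 (volume.restrict (Ioo 0 L))) (u : L2 L),
      innerSL ℝ (hg.toLp g) u = ∫ x in Ioo 0 L, u x * g x := by
    intro g hg u
    rw [innerSL_apply_apply, L2.inner_def]
    refine integral_congr_ae ?_
    filter_upwards [hg.coeFn_toLp] with x hx
    rw [hx]; simp
  rw [← hin m1, ← hin m2, ← ContinuousLinearMap.intervalIntegral_comp_comm _ hy,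
    ← ContinuousLinearMap.intervalIntegral_comp_comm _ hv, ← intervalIntegral.integral_neg]
  refine intervalIntegral.integral_congr_ae ?_
  rw [ae_restrict_iff' measurableSet_Ioi] at h
  filter_upwards [h] with t ht htT
  rw [uIoc_of_le hT] at htT
  rw [hin, hin]
  exact ht htT.1 φ h1 h2 h3

/-! ### Decay from the energy inequality -/

/-- Grönwall's lemma for decay: unlike the usual integral form, the inequality is needed between all
times `p ≤ q`. -/
theorem le_mul_exp_of_integral_le {E : ℝ → ℝ} {s μ : ℝ} (hc : ContinuousOn E (Ici s))
    (h : ∀ p q, s ≤ p → p ≤ q → E q ≤ E p - μ * ∫ r in p..q, E r) {t : ℝ} (ht : s ≤ t) :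
    E t ≤ E s * Real.exp (-μ * (t - s)) := by
  have hsub : ContinuousOn E (Icc s t) := hc.mono Icc_subset_Ici_self
  have := le_gronwallBound_of_liminf_deriv_right_le (f := E) (f' := fun x => -μ * E x) (δ := E s)
    (K := -μ) (ε := 0) (a := s) (b := t) hsub ?_ le_rfl (fun x _ => by simp) t ⟨ht, le_rfl⟩
  · rwa [gronwallBound_ε0] at this
  intro x hx r hr
  refine Eventually.frequently ?_
  have hcx : ContinuousOn E (Ici x) := hc.mono (Ici_subset_Ici.2 hx.1)
  have hd : HasDerivWithinAt (fun u => ∫ r in x..u, E r) (E x) (Ici x) x :=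
    intervalIntegral.integral_hasDerivWithinAt_right (t := Ioi x) (by simp)
      ⟨Ioi x, self_mem_nhdsWithin,
        (hcx.mono Ioi_subset_Ici_self).aestronglyMeasurable measurableSet_Ioi⟩
      ((hcx x self_mem_Ici).mono Ioi_subset_Ici_self)
  have hd' := (hasDerivWithinAt_iff_tendsto_slope.1 (hd.const_mul (-μ)))
  rw [Ici_sdiff_left] at hd'
  filter_upwards [hd'.eventually (gt_mem_nhds hr), self_mem_nhdsWithin] with z hz hxz
  refine lt_of_le_of_lt ?_ hz
  have hxz' : x < z := hxz
  simp only [slope, vsub_eq_sub, smul_eq_mul, intervalIntegral.integral_same, mul_zero, sub_zero]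
  refine mul_le_mul_of_nonneg_left ?_ (inv_nonneg.2 (sub_nonneg.2 hxz'.le))
  linarith [h x z hx.1 hxz'.le]

/-- The energy inequality of the saturated equation, in terms of `N t = ‖y(t)‖`. -/
structure SatEnergy (a us : ℝ) (N : ℝ → ℝ) : Prop where
  nonneg : ∀ t, 0 ≤ N t
  continuousOn : ContinuousOn N (Ici 0)
  le : ∀ s t, 0 ≤ s → s ≤ t →
    N t ^ 2 ≤ N s ^ 2 - 2 * ∫ r in s..t, min (a * N r) us * N r

namespace SatEnergy

variable {a us : ℝ} {N : ℝ → ℝ}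

theorem le_of_le (h : SatEnergy a us N) (ha : 0 < a) (hus : 0 < us) {s t : ℝ} (hs : 0 ≤ s)
    (hst : s ≤ t) : N t ≤ N s := by
  have h1 : 0 ≤ ∫ r in s..t, min (a * N r) us * N r :=
    intervalIntegral.integral_nonneg hst fun r _ =>
      mul_nonneg (le_min (mul_nonneg ha.le (h.nonneg r)) hus.le) (h.nonneg r)
  have h2 : N t ^ 2 ≤ N s ^ 2 := by linarith [h.le s t hs hst]
  exact (pow_le_pow_iff_left₀ (h.nonneg t) (h.nonneg s) two_ne_zero).1 h2

theorem intervalIntegrable (h : SatEnergy a us N) {s t : ℝ} (hs : 0 ≤ s) (hst : s ≤ t) :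
    IntervalIntegrable (fun r => min (a * N r) us * N r) volume s t := by
  have hc := h.continuousOn.mono (show uIcc s t ⊆ Ici 0 by
    rw [uIcc_of_le hst]; exact fun r hr => hs.trans hr.1)
  exact (((continuousOn_const.mul hc).inf continuousOn_const).mul hc).intervalIntegrable

theorem le_mul_exp (h : SatEnergy a us N) (ha : 0 < a) (hus : 0 < us) {s t r : ℝ} (hs : 0 ≤ s)
    (hst : s ≤ t) (hr : 0 < r) (hNr : N s ≤ r) :
    N t ≤ N s * Real.exp (-(min a (us / r)) * (t - s)) := by
  set μ := min a (us / r)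
  have hμr : μ * r ≤ us := (le_div_iff₀ hr).1 (min_le_right _ _)
  have hμ : 0 < μ := lt_min ha (div_pos hus hr)
  have key := le_mul_exp_of_integral_le (E := fun t => N t ^ 2) (μ := 2 * μ)
    ((h.continuousOn.mono (Ici_subset_Ici.2 hs)).pow 2) (fun p q hp hpq => by
      have hc : ContinuousOn N (uIcc p q) := h.continuousOn.mono (by
        rw [uIcc_of_le hpq]; exact fun r hr => (hs.trans hp).trans hr.1)
      have h1 := h.le p q (hs.trans hp) hpq
      have h2 : ∫ r in p..q, μ * N r ^ 2 ≤ ∫ r in p..q, min (a * N r) us * N r := by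
        refine intervalIntegral.integral_mono_on hpq ((hc.pow 2).const_mul μ).intervalIntegrable
          (h.intervalIntegrable (hs.trans hp) hpq) fun x hx => ?_
        have hx0 := h.nonneg x
        have hxr : N x ≤ r := (h.le_of_le ha hus hs (hp.trans hx.1)).trans hNr
        have h3 : μ * N x ≤ min (a * N x) us :=
          le_min (mul_le_mul_of_nonneg_right (min_le_left _ _) hx0)
            ((mul_le_mul_of_nonneg_left hxr hμ.le).trans hμr)
        nlinarith
      rw [intervalIntegral.integral_const_mul] at h2
      linarith) hst
  have h4 : N t ^ 2 ≤ (N s * Real.exp (-μ * (t - s))) ^ 2 := by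
    rw [mul_pow, ← Real.exp_nat_mul]
    convert! key using 3
    push_cast; ring
  exact (pow_le_pow_iff_left₀ (h.nonneg t) (mul_nonneg (h.nonneg s) (Real.exp_nonneg _))
    two_ne_zero).1 h4

/-- At the time `T = a N(0)² / (2 us²)` the saturation is inactive: otherwise the dissipation up to
`T` would be at least `2 T us² / a = N(0)²`, the whole initial energy. -/
theorem le_div_of_le (h : SatEnergy a us N) (ha : 0 < a) (hus : 0 < us) :
    N (a * N 0 ^ 2 / (2 * us ^ 2)) ≤ us / a := by
  set T := a * N 0 ^ 2 / (2 * us ^ 2) with hT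
  have hT0 : 0 ≤ T := by positivity
  by_contra! hcon
  have h1 := h.le 0 T le_rfl hT0
  have h2 : ∫ r in (0 : ℝ)..T, us * (us / a) ≤ ∫ r in (0 : ℝ)..T, min (a * N r) us * N r := by
    refine intervalIntegral.integral_mono_on hT0 intervalIntegrable_const
      (h.intervalIntegrable le_rfl hT0) fun x hx => ?_
    have hx1 : us / a ≤ N x := hcon.le.trans (h.le_of_le ha hus hx.1 hx.2)
    rw [min_eq_right (by rwa [div_le_iff₀' ha] at hx1)]
    exact mul_le_mul_of_nonneg_left hx1 hus.le
  rw [intervalIntegral.integral_const, smul_eq_mul, sub_zero] at h2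
  have h3 : T * (us * (us / a)) = N 0 ^ 2 / 2 := by rw [hT]; field_simp
  have h4 : 0 < N T := (div_pos hus ha).trans hcon
  nlinarith [pow_pos h4 2]

theorem le_mul_exp_global (h : SatEnergy a us N) (ha : 0 < a) (hus : 0 < us) {t : ℝ} (ht : 0 ≤ t) :
    N t ≤ N 0 * Real.exp (a ^ 2 * N 0 ^ 2 / (2 * us ^ 2)) * Real.exp (-a * t) := by
  set T := a * N 0 ^ 2 / (2 * us ^ 2) with hT
  have hT0 : 0 ≤ T := by positivity
  have he : a ^ 2 * N 0 ^ 2 / (2 * us ^ 2) = a * T := by rw [hT]; ring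
  rw [he, mul_assoc, ← Real.exp_add]
  rcases le_total t T with htT | htT
  · refine (h.le_of_le ha hus le_rfl ht).trans (le_mul_of_one_le_right (h.nonneg 0) ?_)
    rw [Real.one_le_exp_iff]
    nlinarith
  · have h1 := h.le_mul_exp ha hus hT0 htT (div_pos hus ha) (h.le_div_of_le ha hus)
    rw [div_div_cancel₀ hus.ne', min_self] at h1
    refine h1.trans ?_
    have h2 : -a * (t - T) = a * T + -a * t := by ring
    rw [h2]
    exact mul_le_mul_of_nonneg_right (h.le_of_le ha hus le_rfl hT0) (Real.exp_nonneg _)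

end SatEnergy

/-! ### The saturation map -/

theorem sat_eq_smul {us : ℝ} (hus : 0 < us) {L : ℝ} (s : L2 L) : sat us s = (us / max us ‖s‖) • s := by
  unfold sat
  split_ifs with h
  · rw [max_eq_left h, div_self hus.ne', one_smul]
  · rw [max_eq_right (not_le.1 h).le]

theorem continuous_sat {us : ℝ} (hus : 0 < us) {L : ℝ} : Continuous (sat us : L2 L → L2 L) := by
  have h : (sat us : L2 L → L2 L) = fun s => (us / max us ‖s‖) • s := funext (sat_eq_smul hus)
  rw [h]
  refine (continuous_const.div (continuous_const.max continuous_norm) fun s => ?_).smul continuous_id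
  exact (hus.trans_le (le_max_left _ _)).ne'

theorem inner_sat {a us : ℝ} (ha : 0 < a) (hus : 0 < us) {L : ℝ} (w : L2 L) :
    inner ℝ w (sat us (a • w)) = min (a * ‖w‖) us * ‖w‖ := by
  have hn : ‖a • w‖ = a * ‖w‖ := by rw [norm_smul, Real.norm_of_nonneg ha.le]
  rw [sat_eq_smul hus, hn, real_inner_smul_right, real_inner_smul_right, real_inner_self_eq_norm_sq]
  rcases le_total (a * ‖w‖) us with h | h
  · rw [max_eq_left h, min_eq_left h, div_self hus.ne']; ring
  · have h0 : a * ‖w‖ ≠ 0 := (hus.trans_le h).ne'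
    have h1 : ‖w‖ ≠ 0 := right_ne_zero_of_mul h0
    rw [max_eq_right h, min_eq_right h]; field_simp

/-! ### The energy inequality for the saturated Korteweg-de Vries equation -/

/-- A function whose primitive vanishes is zero almost everywhere, by Lebesgue differentiation. -/
theorem ae_eq_zero_of_intervalIntegral_eq_zero {k : ℝ → ℝ}
    (hk : ∀ T, 0 ≤ T → IntervalIntegrable k volume 0 T)
    (h : ∀ T, 0 ≤ T → ∫ t in (0 : ℝ)..T, k t = 0) :
    ∀ᵐ t ∂(volume.restrict (Ioi (0 : ℝ))), k t = 0 := by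
  rw [ae_restrict_iff' measurableSet_Ioi]
  have h1 : ∀ n : ℕ, ∀ᵐ x, x ∈ uIcc 0 (n : ℝ) → ∀ c ∈ uIcc 0 (n : ℝ),
      HasDerivAt (fun x => ∫ t in c..x, k t) (k x) x :=
    fun n => (hk n n.cast_nonneg).ae_hasDerivAt_integral
  filter_upwards [ae_all_iff.2 h1] with x hx hx0
  obtain ⟨n, hn⟩ := exists_nat_ge x
  have hx0' : 0 < x := hx0
  have h2 := hx n (by rw [uIcc_of_le n.cast_nonneg]; exact ⟨hx0'.le, hn⟩) 0 left_mem_uIcc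
  have h3 : (fun x => ∫ t in (0 : ℝ)..x, k t) =ᶠ[𝓝 x] fun _ => 0 := by
    filter_upwards [Ioi_mem_nhds hx0'] with u hu using h u (le_of_lt hu)
  exact h2.unique ((hasDerivAt_const x (0 : ℝ)).congr_of_eventuallyEq h3)

/-- The energy inequality of the saturated Korteweg-de Vries equation. -/
theorem IsMildSolution.satEnergy {L a us : ℝ} (hL : 0 < L) (ha : 0 < a) (hus : 0 < us) {y₀ : L2 L}
    {y : ℝ → L2 L} (h : IsMildSolution L a us y₀ y) :
    SatEnergy a us (fun t => ‖y t‖) ∧ y 0 = y₀ := by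
  obtain ⟨hyc, yx, hyx, hwd, W, ⟨hW, hgen⟩, hmild⟩ := h
  have hc : ∀ t, 0 ≤ t → ∀ x, ‖W t x‖ ≤ ‖x‖ := fun t ht x =>
    hW.norm_apply_le (fun w z hwz => ((hgen w z).1 hwz).inner_nonpos hL) ht x
  have hy_int : ∀ T, 0 ≤ T → IntervalIntegrable y volume 0 T := fun T hT =>
    (hyc.mono (by rw [uIcc_of_le hT]; exact Icc_subset_Ici_self)).intervalIntegrable
  have hyx_mem : ∀ T, 0 ≤ T → MemLp yx 2 (volume.restrict (Ioc 0 T)) := fun T hT =>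
    (hyx (T + 1) (by linarith)).mono_measure
      (Measure.restrict_mono (show Ioc 0 T ⊆ Ioo 0 (T + 1) from
        fun t ht => ⟨ht.1, ht.2.trans_lt (lt_add_one T)⟩) le_rfl)
  have hyx_int : ∀ T, 0 ≤ T → IntervalIntegrable yx volume 0 T := fun T hT =>
    (intervalIntegrable_iff_integrableOn_Ioc_of_le hT).2 ((hyx_mem T hT).integrable (by norm_num))
  have hwd' := (ae_restrict_iff' measurableSet_Ioi).1 hwd
  have hg_int : ∀ T, 0 ≤ T → IntervalIntegrable (fun t => mulL2 (y t) (yx t)) volume 0 T := by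
    intro T hT
    rw [intervalIntegrable_iff_integrableOn_Ioc_of_le hT]
    obtain ⟨C, hC⟩ := isCompact_Icc.exists_bound_of_continuousOn 
      (hyc.mono (Icc_subset_Ici_self : Icc 0 T ⊆ Ici 0))
    have hym := ((intervalIntegrable_iff_integrableOn_Ioc_of_le hT).1 (hy_int T hT)).1
    have hyxm := (hyx_mem T hT).1
    have hI : IntegrableOn (fun t => mulH1 L (y t, yx t) (yx t)) (Ioc 0 T) := by
      have hb : Integrable (fun t => ‖mulH1 L‖ * (C * ‖yx t‖ + ‖yx t‖ ^ 2)) (volume.restrict (Ioc 0 T)) :=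
        ((((hyx_mem T hT).integrable (by norm_num)).norm.const_mul C).add
          ((memLp_two_iff_integrable_sq_norm hyxm).1 (hyx_mem T hT))).const_mul _
      refine hb.mono' ?_ ?_
      · have hcont : Continuous fun p : L2 L × L2 L => mulH1 L p p.2 :=
          (mulH1 L).continuous.clm_apply continuous_snd
        exact hcont.comp_aestronglyMeasurable (hym.prodMk hyxm)
      · filter_upwards [ae_restrict_mem measurableSet_Ioc] with t ht
        have h1 : ‖(y t, yx t)‖ ≤ C + ‖yx t‖ := by
          rw [Prod.norm_def]
          have h2 := hC t ⟨ht.1.le, ht.2⟩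
          exact max_le (by simp only; linarith [norm_nonneg (yx t)])
            (by simp only; linarith [(norm_nonneg (y t)).trans h2])
        calc ‖mulH1 L (y t, yx t) (yx t)‖ ≤ ‖mulH1 L‖ * ‖(y t, yx t)‖ * ‖yx t‖ :=
              (mulH1 L).le_opNorm₂ _ _
          _ ≤ ‖mulH1 L‖ * (C + ‖yx t‖) * ‖yx t‖ := by gcongr
          _ = ‖mulH1 L‖ * (C * ‖yx t‖ + ‖yx t‖ ^ 2) := by ring
    refine hI.congr ((ae_restrict_iff' measurableSet_Ioc).2 ?_)
    filter_upwards [hwd'] with t ht htT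
    exact ((ht htT.1).mulL2_eq hL _).symm
  have hsat_int : ∀ T, 0 ≤ T → IntervalIntegrable (fun t => sat us (a • y t)) volume 0 T := fun T hT =>
    ((continuous_sat hus).comp_continuousOn ((hyc.mono (by
      rw [uIcc_of_le hT]; exact Icc_subset_Ici_self)).const_smul a)).intervalIntegrable
  set f : ℝ → L2 L := fun t => mulL2 (y t) (yx t) + sat us (a • y t) with hf
  have hf_int : ∀ T, 0 ≤ T → IntervalIntegrable f volume 0 T := fun T hT =>
    (hg_int T hT).add (hsat_int T hT)
  have hsol : IsMildSol W f y₀ y := by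
    intro t ht
    have hm : ∀ u : ℝ → L2 L, ∫ s in (0 : ℝ)..t, W (t - s) (u s)
        = ∫ s in (0 : ℝ)..t, W (max (t - s) 0) (u s) := fun u => by
      refine intervalIntegral.integral_congr fun s hs => ?_
      rw [uIcc_of_le ht] at hs
      simp only [max_eq_left (sub_nonneg.2 hs.2)]
    rw [hmild t ht, hm, hm, sub_sub, ← intervalIntegral.integral_add
      (hW.intervalIntegrable_apply hc (hg_int t ht) (c := fun s => t - s) (by fun_prop))
      (hW.intervalIntegrable_apply hc (hsat_int t ht) (c := fun s => t - s) (by fun_prop))]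
    simp only [hf, map_add]
  -- time integrals of `y` satisfy the boundary conditions, hence so does `y t` for almost every `t`
  have htr : ∀ ℓ : L2 L × L2 L →L[ℝ] ℝ,
      (∀ w v : L2 L, HasWeakDeriv L w v → HasValueAt L w 0 0 → HasValueAt L w L 0 → ℓ (w, v) = 0) →
      ∀ᵐ t ∂(volume.restrict (Ioi (0 : ℝ))), ℓ (y t, yx t) = 0 := by
    intro ℓ hℓ
    have hpair : ∀ T, 0 ≤ T → IntervalIntegrable (fun t => (y t, yx t)) volume 0 T := fun T hT =>
      ⟨(hy_int T hT).1.prodMk (hyx_int T hT).1, (hy_int T hT).2.prodMk (hyx_int T hT).2⟩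
    refine ae_eq_zero_of_intervalIntegral_eq_zero (fun T hT =>
      ⟨ℓ.integrable_comp (hpair T hT).1, ℓ.integrable_comp (hpair T hT).2⟩) fun T hT => ?_
    obtain ⟨z, hz⟩ := hsol.exists_generatorGraph hW hc hf_int hT
    obtain ⟨w₁, w₂, w₃, -, -, -, h0, h1, -, -⟩ := (hgen _ _).1 hz
    rw [ContinuousLinearMap.intervalIntegral_comp_comm _ (hpair T hT)]
    have hprod : ∫ t in (0 : ℝ)..T, (y t, yx t) = (∫ t in (0 : ℝ)..T, y t, ∫ t in (0 : ℝ)..T, yx t) := by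
      simp only [intervalIntegral.integral_of_le hT]
      exact integral_pair (hy_int T hT).1 (hyx_int T hT).1
    rw [hprod]
    exact hℓ _ _ (hasWeakDeriv_intervalIntegral hT (hy_int T hT) (hyx_int T hT) hwd) h0 h1
  have hz := htr (traceZero L) fun w v hwv h0 _ => hwv.traceZero_eq hL h0
  have hr := htr (traceRight L) fun w v hwv _ h1 => hwv.traceRight_eq hL h1
  have hinner : ∀ᵐ t ∂(volume.restrict (Ioi (0 : ℝ))),
      inner ℝ (y t) (f t) = min (a * ‖y t‖) us * ‖y t‖ := by
    filter_upwards [hz, hr, hwd] with t h0 h1 hw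
    rw [hf, inner_add_right, hw.inner_mulL2_eq_zero hL h0 h1, inner_sat ha hus, zero_add]
  refine ⟨⟨fun t => norm_nonneg _, hyc.norm, fun s t hs hst => ?_⟩, ?_⟩
  · refine (hsol.energy_le hW hc hf_int hyc hs hst).trans_eq ?_
    congr 2
    refine intervalIntegral.integral_congr_ae ?_
    filter_upwards [(ae_restrict_iff' measurableSet_Ioi).1 hinner] with r hr' hrst
    rw [uIoc_of_le hst] at hrst
    exact hr' (hs.trans_lt hrst.1)
  · simpa [hW.map_zero] using hmild 0 le_rfl

/-- The gain `s ↦ s exp(a² s² / (2 us²))` of the global decay estimate. -/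
noncomputable def gain (a us : ℝ) (s : ℝ≥0) : ℝ≥0 :=
  s * (Real.exp (a ^ 2 * (s : ℝ) ^ 2 / (2 * us ^ 2))).toNNReal

theorem isClassK_gain (a us : ℝ) : IsClassK (gain a us) where
  continuous := by unfold gain; fun_prop
  strictMono s t hst := by
    unfold gain
    refine mul_lt_mul hst (Real.toNNReal_le_toNNReal (Real.exp_le_exp.2 ?_))
      (Real.toNNReal_pos.2 (Real.exp_pos _)) zero_le
    have : (s : ℝ) ≤ t := by exact_mod_cast hst.le
    gcongr
  map_zero := by simp [gain]

end SatKdV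


theorem theorem2 (a us : ℝ) (ha : 0 < a) (hus : 0 < us) :
    (∃ α : ℝ≥0 → ℝ≥0, SatKdV.IsClassK α ∧
      ∀ (L : ℝ), 0 < L → ∀ (y₀ : SatKdV.L2 L) (y : ℝ → SatKdV.L2 L),
        SatKdV.IsMildSolution L a us y₀ y →
          ∀ t : ℝ, 0 ≤ t → ‖y t‖ ≤ (α ‖y₀‖₊ : ℝ) * Real.exp (-a * t)) ∧
    (∀ r : ℝ, 0 < r →
      ∀ (L : ℝ), 0 < L → ∀ (y₀ : SatKdV.L2 L), ‖y₀‖ ≤ r → ∀ (y : ℝ → SatKdV.L2 L),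
        SatKdV.IsMildSolution L a us y₀ y →
          ∀ t : ℝ, 0 ≤ t → ‖y t‖ ≤ ‖y₀‖ * Real.exp (-(min a (us / r)) * t)) := by
  refine ⟨⟨SatKdV.gain a us, SatKdV.isClassK_gain a us, fun L hL y₀ y hy t ht => ?_⟩,
    fun r hr L hL y₀ hy₀ y hy t ht => ?_⟩
  · obtain ⟨h, rfl⟩ := hy.satEnergy hL ha hus
    simpa [SatKdV.gain, Real.coe_toNNReal _ (Real.exp_nonneg _)] using h.le_mul_exp_global ha hus ht
  · obtain ⟨h, rfl⟩ := hy.satEnergy hL ha hus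
    simpa using h.le_mul_exp ha hus le_rfl ht hr hy₀
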